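/- A ranking of a finite set $C$ of $m$ candidates is a strict linear order on $C$. The Kendall tau distance $\mathrm{KT}(\pi,\rho)$ of two rankings of $C$ is the number of unordered pairs of candidates whose relative order differs in $\pi$ and $\rho$. In the problem Ranking Deletion-Kemeny Score, the input consists of a finite set $C$ of candidates, a tuple $\mathcal R=(R_1,\dots,R_n)$ of rankings of $C$, a ranking $X$ of $C$, a deletion cost $\mathrm{cost}(R_i)\in\mathbb N$ for each $i\in\{1,\dots,n\}$ (repeated rankings are allowed, and each occurrence has its own cost), a budget $\mathrm{bgt}\in\mathbb N$ and an integer $k$. All numbers are written in binary. The question is whether there is a set $S\subseteq\{1,\dots,n\}$ of rankings to delete such that $$\sum_{i\in S}\mathrm{cost}(R_i)\le \mathrm{bgt}\qquad\text{and}\qquad \sum_{i\in\{1,\dots,n\}\setminus S}\mathrm{KT}(X,R_i)\le k .$$ Theorem. Ranking Deletion-Kemeny Score can be solved in polynomial time: there are a Turing machine and a polynomial $p$ such that on (the encoding of) every instance the machine halts with the correct answer after at most $p(\ell)$ steps, where $\ell$ is the length of the encoding of the instance. -/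

import Mathlib

namespace KemenyScore

open Computability Turing

/-- A ranking (a complete strict order) of the `m` candidates `0, …, m - 1`: the permutation `π`
lists the candidates from first to last, `π i` being the candidate in position `i`. -/
abbrev Ranking (m : ℕ) : Type := Equiv.Perm (Fin m)

/-- `c` is placed before `c'` in `π`. -/
def Ranking.Before {m : ℕ} (π : Ranking m) (c c' : Fin m) : Prop :=
  π.symm c < π.symm c'

instance {m : ℕ} (π : Ranking m) (c c' : Fin m) : Decidable (π.Before c c') :=
  inferInstanceAs (Decidable (π.symm c < π.symm c'))

/-- The Kendall tau distance: the number of unordered pairs of candidates whose relative order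
differs in `π` and `ρ`. Every such pair is counted once, as the ordered pair `(c, c')` with `c`
before `c'` in `π`. -/
def kendallTau {m : ℕ} (π ρ : Ranking m) : ℕ :=
  (Finset.univ.filter fun p : Fin m × Fin m => π.Before p.1 p.2 ∧ ρ.Before p.2 p.1).card

/-- An instance of Ranking Deletion-Kemeny Score. The rankings form an ordered tuple, so equal
rankings may occur several times, each occurrence with its own deletion cost. -/
structure Instance where
  /-- the number of candidates -/
  m : ℕ
  /-- the number of given rankings -/
  n : ℕ
  /-- the given rankings -/
  R : Fin n → Ranking m
  /-- the distinguished ranking -/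
  X : Ranking m
  /-- the costs of deleting the given rankings -/
  cost : Fin n → ℕ
  /-- the budget -/
  bgt : ℕ
  /-- the bound on the total distance -/
  k : ℤ

/-- The instance `I` is a yes-instance: a set `S` of the given rankings can be deleted within the
budget so that the total Kendall tau distance of `X` from the remaining rankings is at most `k`. -/
def Instance.IsYes (I : Instance) : Prop :=
  ∃ S : Finset (Fin I.n), ∑ i ∈ S, I.cost i ≤ I.bgt ∧
    ((∑ i ∈ Sᶜ, kendallTau I.X (I.R i) : ℕ) : ℤ) ≤ I.k

/-! ### Encoding of instances as words over the alphabet of binary digits, brackets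
and comma; all numbers are written in binary. -/

/-- A natural number in binary, least significant digit first, closed by a comma. -/
def encNat (a : ℕ) : List Γ' :=
  (encodeNat a).map Γ'.bit ++ [Γ'.comma]

/-- An integer: a sign digit (`true` for a negative number), followed by the absolute value. -/
def encInt (a : ℤ) : List Γ' :=
  Γ'.bit (decide (a < 0)) :: encNat a.natAbs

/-- A ranking: the bracketed list of the candidates from first to last. -/
def encRanking {m : ℕ} (π : Ranking m) : List Γ' :=
  Γ'.bra :: (List.ofFn fun i => encNat (π i)).flatten ++ [Γ'.ket]

/-- An instance: the ranking `X` (which also lists the candidates), the budget, the bound `k` and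
the bracketed list of the given rankings, each followed by its cost. -/
def Instance.encode (I : Instance) : List Γ' :=
  encRanking I.X ++ encNat I.bgt ++ encInt I.k ++
    Γ'.bra :: (List.ofFn fun i => encRanking (I.R i) ++ encNat (I.cost i)).flatten ++ [Γ'.ket]

open Classical in
/-- The decision problem `P` on objects encoded by `enc` is solvable in polynomial time: some
Turing machine halts with the correct answer (one Boolean) on the encoding of every object `a`,
after a number of steps at most polynomial in the length of that encoding. -/
def SolvableInPolyTime {α Γ : Type} (enc : α → List Γ) (P : α → Prop) : Prop :=
  Nonempty (TM2ComputableInPolyTime enc encodeBool fun a => decide (P a))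

end KemenyScore

/-! ### Structured stack programs and their compilation to Turing machines. -/

open Turing

/-! Deletion within a budget is a knapsack problem: each ranking has a weight, its distance from
`X`, and a cost, and both the kept weight and the deletion cost must be small. Knapsack is hard for
binary numbers, but a distance is at most the number of pairs of candidates, and the encoding lists
every candidate. Hence the total weight `W` is polynomial in the input length; only the costs can be
exponentially large.

Going through the rankings, one stores the attainable pairs of kept weight and deletion cost and
drops dominated ones. The surviving pairs have distinct weights, so there are at most `W + 1` of
them (`Knapsack.length_prune_le`), and costs are merely added and compared in binary. Every stored
pair is attained, and every attainable pair is dominated by a stored one (`Knapsack.front_sound`,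
`Knapsack.front_complete`). So the answer is yes iff `k` is nonnegative and some stored pair obeys
both bounds (`KemenyScore.answer_data`).

To obtain a machine, structured stack programs are compiled to `TM2` machines step for step
(`StackProg.Exec.steps`). Values are binary trees, written in prefix code on a stack. `PolyTime f`
says that a program replaces the tree of the argument by the tree of the value in polynomial time,
whatever lies on the stacks besides. This class is closed under composition, pairing, case
distinction and folds, provided that the accumulators of a fold stay polynomially bounded. In
`PolyTime.front` this proviso is exactly the bound on the Pareto front. -/

/-- Structured programs over a family of stacks. -/
inductive StackProg {K : Type} (Γ : K → Type) : Type
  | skip : StackProg Γ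
  | push (k : K) (a : Γ k) : StackProg Γ
  | pop (k : K) : StackProg Γ
  | seq (p q : StackProg Γ) : StackProg Γ
  | ite (k : K) (f : Option (Γ k) → Bool) (p q : StackProg Γ) : StackProg Γ
  | loop (k : K) (f : Option (Γ k) → Bool) (p : StackProg Γ) : StackProg Γ

namespace StackProg

variable {K : Type} {Γ : K → Type}

section Exec

variable [DecidableEq K]

/-- Big-step semantics: `p.Exec s s' t` says that `p` leads from `s` to `s'` in `t` steps. -/
inductive Exec : StackProg Γ → (∀ k, List (Γ k)) → (∀ k, List (Γ k)) → ℕ → Prop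
  | skip (s) : Exec skip s s 1
  | push (k a s) : Exec (push k a) s (Function.update s k (a :: s k)) 1
  | pop (k s) : Exec (pop k) s (Function.update s k (s k).tail) 1
  | seq {p q s s' s'' t t'} : Exec p s s' t → Exec q s' s'' t' → Exec (seq p q) s s'' (t + t')
  | ite_true {k f p q s s' t} : f (s k).head? = true → Exec p s s' t →
      Exec (ite k f p q) s s' (t + 1)
  | ite_false {k f p q s s' t} : f (s k).head? = false → Exec q s s' t →
      Exec (ite k f p q) s s' (t + 1)
  | loop_true {k f p s s' s'' t t'} : f (s k).head? = true → Exec p s s' t →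
      Exec (loop k f p) s' s'' t' → Exec (loop k f p) s s'' (t + t' + 1)
  | loop_false {k f p s} : f (s k).head? = false → Exec (loop k f p) s s 1

end Exec

/-- The labels of the Turing machine that runs a program. -/
def Lab : StackProg Γ → Type
  | skip => Unit
  | push _ _ => Unit
  | pop _ => Unit
  | seq p q => Lab p ⊕ Lab q
  | ite _ _ p q => Option (Lab p ⊕ Lab q)
  | loop _ _ p => Option (Lab p)

theorem finite_lab : ∀ p : StackProg Γ, Finite p.Lab
  | skip => inferInstanceAs (Finite Unit)
  | push _ _ => inferInstanceAs (Finite Unit)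
  | pop _ => inferInstanceAs (Finite Unit)
  | seq p q => by
    have := finite_lab p
    have := finite_lab q
    exact inferInstanceAs (Finite (p.Lab ⊕ q.Lab))
  | ite _ _ p q => by
    have := finite_lab p
    have := finite_lab q
    exact inferInstanceAs (Finite (Option (p.Lab ⊕ q.Lab)))
  | loop _ _ p => by
    have := finite_lab p
    exact inferInstanceAs (Finite (Option p.Lab))

/-- The label at which the execution of a program starts. -/
def entry : ∀ p : StackProg Γ, p.Lab
  | skip => ()
  | push _ _ => ()
  | pop _ => ()
  | seq p _ => Sum.inl (entry p)
  | ite _ _ _ _ => none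
  | loop _ _ _ => none

/-- The statement at a label of a program whose labels are embedded by `e` into `Λ` and which
continues at `next`. -/
def code {Λ : Type} : ∀ p : StackProg Γ, (p.Lab → Λ) → Λ → p.Lab → TM2.Stmt Γ Λ Bool
  | skip, _, next, _ => .goto fun _ => next
  | push k a, _, next, _ => .push k (fun _ => a) (.goto fun _ => next)
  | pop k, _, next, _ => .pop k (fun v _ => v) (.goto fun _ => next)
  | seq p q, e, _, Sum.inl l => code p (fun l => e (Sum.inl l)) (e (Sum.inr q.entry)) l
  | seq _ q, e, next, Sum.inr l => code q (fun l => e (Sum.inr l)) next l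
  | ite k f p q, e, _, none => .peek k (fun _ o => f o) (.branch id
      (.goto fun _ => e (some (Sum.inl p.entry))) (.goto fun _ => e (some (Sum.inr q.entry))))
  | ite _ _ p _, e, next, some (Sum.inl l) => code p (fun l => e (some (Sum.inl l))) next l
  | ite _ _ _ q, e, next, some (Sum.inr l) => code q (fun l => e (some (Sum.inr l))) next l
  | loop k f p, e, next, none => .peek k (fun _ o => f o) (.branch id
      (.goto fun _ => e (some p.entry)) (.goto fun _ => next))
  | loop _ _ p, e, _, some l => code p (fun l => e (some l)) (e none) l

section Run

variable [DecidableEq K] {Λ : Type}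

/-- The machine `M` leads from one configuration to another in exactly `n` steps. -/
def Steps (M : Λ → TM2.Stmt Γ Λ Bool) (n : ℕ) (c c' : TM2.Cfg Γ Λ Bool) : Prop :=
  (flip bind (TM2.step M))^[n] (some c) = some c'

theorem Steps.trans {M : Λ → TM2.Stmt Γ Λ Bool} {n n' : ℕ} {c c' c'' : TM2.Cfg Γ Λ Bool}
    (h : Steps M n c c') (h' : Steps M n' c' c'') : Steps M (n + n') c c'' := by
  unfold Steps at *
  rw [add_comm, Function.iterate_add_apply, h, h']

theorem Steps.one {M : Λ → TM2.Stmt Γ Λ Bool} {c c' : TM2.Cfg Γ Λ Bool}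
    (h : TM2.step M c = some c') : Steps M 1 c c' := h

theorem step_entry {M : Λ → TM2.Stmt Γ Λ Bool} {p : StackProg Γ} {e : p.Lab → Λ} {next : Λ}
    (hM : ∀ l, M (e l) = p.code e next l) (v : Bool) (s : ∀ k, List (Γ k)) :
    TM2.step M ⟨some (e p.entry), v, s⟩ = some (TM2.stepAux (p.code e next p.entry) v s) := by
  rw [TM2.step, hM]

/-- Induction on the execution: a subprogram runs at its own labels, with the point after it as
continuation. The Boolean state only carries the outcome of a test from `peek` to `branch`, so its
initial value is arbitrary and its final value irrelevant. -/
theorem Exec.steps {p : StackProg Γ} {s s' : ∀ k, List (Γ k)} {t : ℕ} (h : p.Exec s s' t)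
    (M : Λ → TM2.Stmt Γ Λ Bool) (e : p.Lab → Λ) (next : Λ) (hM : ∀ l, M (e l) = p.code e next l)
    (v : Bool) : ∃ v', Steps M t ⟨some (e p.entry), v, s⟩ ⟨some next, v', s'⟩ := by
  induction h generalizing next v with
  | skip s => exact ⟨v, .one ((step_entry hM _ _).trans (by simp [code]))⟩
  | push k a s => exact ⟨v, .one ((step_entry hM _ _).trans (by simp [code]))⟩
  | pop k s => exact ⟨v, .one ((step_entry hM _ _).trans (by simp [code]))⟩
  | @seq p q s s' s'' t t' _ _ ihp ihq =>
    obtain ⟨v₁, h₁⟩ := ihp (fun l => e (Sum.inl l)) (e (Sum.inr q.entry))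
      (fun l => (hM (Sum.inl l)).trans rfl) v
    obtain ⟨v₂, h₂⟩ := ihq (fun l => e (Sum.inr l)) next (fun l => (hM (Sum.inr l)).trans rfl) v₁
    exact ⟨v₂, h₁.trans h₂⟩
  | @ite_true k f p q s s' t hf _ ih =>
    obtain ⟨v₁, h₁⟩ := ih (fun l => e (some (Sum.inl l))) next
      (fun l => (hM (some (Sum.inl l))).trans rfl) true
    refine ⟨v₁, ?_⟩
    rw [add_comm]
    exact (Steps.one ((step_entry hM _ _).trans (by simp [entry, code, hf]))).trans h₁
  | @ite_false k f p q s s' t hf _ ih =>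
    obtain ⟨v₁, h₁⟩ := ih (fun l => e (some (Sum.inr l))) next
      (fun l => (hM (some (Sum.inr l))).trans rfl) false
    refine ⟨v₁, ?_⟩
    rw [add_comm]
    exact (Steps.one ((step_entry hM _ _).trans (by simp [entry, code, hf]))).trans h₁
  | @loop_true k f p s s' s'' t t' hf _ _ ihp ihl =>
    obtain ⟨v₁, h₁⟩ := ihp (fun l => e (some l)) (e none)
      (fun l => (hM (some l)).trans rfl) true
    obtain ⟨v₂, h₂⟩ := ihl e next hM v₁
    refine ⟨v₂, ?_⟩
    rw [add_comm]
    exact (Steps.one ((step_entry hM _ _).trans (by simp [entry, code, hf]))).trans (h₁.trans h₂)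
  | @loop_false k f p s hf =>
    exact ⟨false, .one ((step_entry hM _ _).trans (by simp [entry, code, hf]))⟩

end Run

/-- The Turing machine that runs a program. -/
noncomputable def toFinTM2 [DecidableEq K] [Fintype K] (p : StackProg Γ) (k₀ k₁ : K)
    [Fintype (Γ k₀)] : FinTM2 :=
  have : Finite p.Lab := finite_lab p
  { K := K
    k₀ := k₀
    k₁ := k₁
    Γ := Γ
    Λ := Option p.Lab
    main := some p.entry
    ΛFin := Fintype.ofFinite _
    σ := Bool
    initialState := false
    m := fun l => match l with
      | some l => p.code some none l
      -- `haltList` prescribes the initial internal state, so the last test outcome is erased. This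
      -- costs the one step beyond the program's time.
      | none => .load (fun _ => false) .halt }

theorem Exec.steps_toFinTM2 [DecidableEq K] [Fintype K] {p : StackProg Γ} {s s' : ∀ k, List (Γ k)}
    {t : ℕ} (h : p.Exec s s' t) (k₀ k₁ : K) [Fintype (Γ k₀)] :
    (flip bind (p.toFinTM2 k₀ k₁).step)^[t + 1]
      (some (⟨some (some p.entry), false, s⟩ : TM2.Cfg Γ (Option p.Lab) Bool)) =
      some (⟨none, false, s'⟩ : TM2.Cfg Γ (Option p.Lab) Bool) := by
  obtain ⟨v, hv⟩ := h.steps (p.toFinTM2 k₀ k₁).m some none (fun _ => rfl) false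
  exact hv.trans (Steps.one (c := ⟨some none, v, s'⟩) (c' := ⟨none, false, s'⟩) rfl)

end StackProg

open Turing

/-- `p.Runs s s' n`: the program `p` leads from `s` to `s'` in at most `n` steps. -/
def StackProg.Runs {K : Type} [DecidableEq K] {Γ : K → Type} (p : StackProg Γ)
    (s s' : ∀ k, List (Γ k)) (n : ℕ) : Prop :=
  ∃ t ≤ n, p.Exec s s' t

namespace StackProg.Runs

variable {K : Type} [DecidableEq K] {Γ : K → Type} {p q : StackProg Γ}
  {s s' s'' : ∀ k, List (Γ k)} {n n' m : ℕ} {k : K} {f : Option (Γ k) → Bool}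

theorem mono (h : p.Runs s s' n) (hn : n ≤ m) : p.Runs s s' m :=
  let ⟨t, ht, h⟩ := h
  ⟨t, ht.trans hn, h⟩

theorem congr (h : p.Runs s s' n) (hs : s' = s'') (hn : n ≤ m) : p.Runs s s'' m :=
  hs ▸ h.mono hn

theorem seq (h : p.Runs s s' n) (h' : q.Runs s' s'' n') : (p.seq q).Runs s s'' (n + n') :=
  let ⟨_, ht, h⟩ := h
  let ⟨_, ht', h'⟩ := h'
  ⟨_, Nat.add_le_add ht ht', h.seq h'⟩

theorem ite_true (hf : f (s k).head? = true) (h : p.Runs s s' n) :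
    (StackProg.ite k f p q).Runs s s' (n + 1) :=
  let ⟨_, ht, h⟩ := h
  ⟨_, Nat.add_le_add_right ht 1, .ite_true hf h⟩

theorem ite_false (hf : f (s k).head? = false) (h : q.Runs s s' n) :
    (StackProg.ite k f p q).Runs s s' (n + 1) :=
  let ⟨_, ht, h⟩ := h
  ⟨_, Nat.add_le_add_right ht 1, .ite_false hf h⟩

theorem loop_true (hf : f (s k).head? = true) (h : p.Runs s s' n)
    (h' : (loop k f p).Runs s' s'' n') : (loop k f p).Runs s s'' (n + n' + 1) :=
  let ⟨_, ht, h⟩ := h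
  let ⟨_, ht', h'⟩ := h'
  ⟨_, Nat.add_le_add_right (Nat.add_le_add ht ht') 1, .loop_true hf h h'⟩

theorem loop_false (hf : f (s k).head? = false) : (loop k f p).Runs s s 1 :=
  ⟨_, le_rfl, .loop_false hf⟩

end StackProg.Runs

/-! ### Binary trees in prefix code and their movement between stacks. -/

/-- Binary trees, the values that programs manipulate. -/
inductive BTree : Type
  | leaf : BTree
  | node (l r : BTree) : BTree

namespace BTree

/-- The prefix code of a tree. -/
def word : BTree → List Bool
  | leaf => [false]
  | node l r => true :: (word l ++ word r)

/-- The length of the prefix code of a tree. -/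
def size : BTree → ℕ
  | leaf => 1
  | node l r => 1 + (size l + size r)

theorem length_word (t : BTree) : t.word.length = t.size := by
  induction t with
  | leaf => rfl
  | node l r hl hr => simp [word, size, hl, hr]; omega

theorem one_le_size (t : BTree) : 1 ≤ t.size := by
  cases t <;> simp [size]

end BTree

/-- The stacks of the machine: input, output, two stacks of trees and an auxiliary stack. -/
inductive Stk : Type
  | inp
  | out
  | a
  | b
  | c
  deriving DecidableEq

instance : Fintype Stk :=
  ⟨{.inp, .out, .a, .b, .c}, fun x => by cases x <;> decide⟩

/-- The alphabets of the stacks. On the stack `b` the words are stored in reverse and separated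
by `none`. -/
def Stk.Alph : Stk → Type
  | inp => Computability.Γ'
  | out => Bool
  | a => Bool
  | b => Option Bool
  | c => Bool

/-- The programs of the machine. -/
abbrev TreeProg : Type := StackProg Stk.Alph

namespace TreeProg

open BTree StackProg

/-- The contents of the stacks. -/
def st (i : List Computability.Γ') (o a : List Bool) (b : List (Option Bool)) (c : List Bool) :
    ∀ k, List (Stk.Alph k)
  | .inp => i
  | .out => o
  | .a => a
  | .b => b
  | .c => c

section Basic

variable {i : List Computability.Γ'} {o a c : List Bool} {b : List (Option Bool)}

theorem runs_pop_inp {x : Computability.Γ'} :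
    StackProg.Runs (pop (Γ := Stk.Alph) .inp) (st (x :: i) o a b c) (st i o a b c) 1 :=
  ⟨1, le_rfl, by
    convert Exec.pop (Γ := Stk.Alph) Stk.inp (st (x :: i) o a b c) using 1
    funext k; cases k <;> rfl⟩

theorem runs_push_out (x : Bool) :
    StackProg.Runs (push (Γ := Stk.Alph) .out x) (st i o a b c) (st i (x :: o) a b c) 1 :=
  ⟨1, le_rfl, by
    convert Exec.push (Γ := Stk.Alph) Stk.out x (st i o a b c) using 1
    funext k; cases k <;> rfl⟩

theorem runs_push_a (x : Bool) :
    StackProg.Runs (push (Γ := Stk.Alph) .a x) (st i o a b c) (st i o (x :: a) b c) 1 :=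
  ⟨1, le_rfl, by
    convert Exec.push (Γ := Stk.Alph) Stk.a x (st i o a b c) using 1
    funext k; cases k <;> rfl⟩

theorem runs_push_b (x : Option Bool) :
    StackProg.Runs (push (Γ := Stk.Alph) .b x) (st i o a b c) (st i o a (x :: b) c) 1 :=
  ⟨1, le_rfl, by
    convert Exec.push (Γ := Stk.Alph) Stk.b x (st i o a b c) using 1
    funext k; cases k <;> rfl⟩

theorem runs_push_c (x : Bool) :
    StackProg.Runs (push (Γ := Stk.Alph) .c x) (st i o a b c) (st i o a b (x :: c)) 1 :=
  ⟨1, le_rfl, by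
    convert Exec.push (Γ := Stk.Alph) Stk.c x (st i o a b c) using 1
    funext k; cases k <;> rfl⟩

theorem runs_pop_a {x : Bool} :
    StackProg.Runs (pop (Γ := Stk.Alph) .a) (st i o (x :: a) b c) (st i o a b c) 1 :=
  ⟨1, le_rfl, by
    convert Exec.pop (Γ := Stk.Alph) Stk.a (st i o (x :: a) b c) using 1
    funext k; cases k <;> rfl⟩

theorem runs_pop_b {x : Option Bool} :
    StackProg.Runs (pop (Γ := Stk.Alph) .b) (st i o a (x :: b) c) (st i o a b c) 1 :=
  ⟨1, le_rfl, by
    convert Exec.pop (Γ := Stk.Alph) Stk.b (st i o a (x :: b) c) using 1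
    funext k; cases k <;> rfl⟩

theorem runs_pop_c {x : Bool} :
    StackProg.Runs (pop (Γ := Stk.Alph) .c) (st i o a b (x :: c)) (st i o a b c) 1 :=
  ⟨1, le_rfl, by
    convert Exec.pop (Γ := Stk.Alph) Stk.c (st i o a b (x :: c)) using 1
    funext k; cases k <;> rfl⟩

end Basic

/-- Test whether a stack of bits has `true` on top. -/
def isTrue : Option Bool → Bool
  | some true => true
  | _ => false

/-- Test whether the stack `b` has a bit on top. -/
def isBit : Option (Option Bool) → Bool
  | some (some _) => true
  | _ => false

/-- Test whether the stack `b` has the bit `true` on top. -/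
def isTrueBit : Option (Option Bool) → Bool
  | some (some true) => true
  | _ => false

/-- Push a word on the stack `a`, the last symbol first. -/
def pushWord : List Bool → TreeProg
  | [] => skip
  | x :: w => seq (pushWord w) (push .a x)

/-- Move symbols from the stack `a` to the stack `b` as long as a tree is incomplete, the number
of missing subtrees being the height of the stack `c`. -/
def saveLoop : TreeProg :=
  loop .c Option.isSome <| seq (pop .c) <|
    seq (ite .a isTrue (seq (push .c true) (seq (push .c true) (push .b (some true))))
      (push .b (some false))) (pop .a)

/-- Move the first tree of the stack `a` to the stack `b`. -/
def save : TreeProg := seq (push .b none) <| seq (push .c true) saveLoop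

/-- Move the bits on top of the stack `b` to the stack `a`. -/
def restoreLoop : TreeProg :=
  loop .b isBit <| seq (ite .b isTrueBit (push .a true) (push .a false)) (pop .b)

/-- Move the first tree of the stack `b` to the stack `a`. -/
def restore : TreeProg := seq restoreLoop (pop .b)

/-- Remove the first tree of the stack `b`. -/
def discard : TreeProg := seq (loop .b isBit (pop .b)) (pop .b)

/-- Move the bits on top of the stack `b` to both the stacks `a` and `c`. -/
def restoreTwiceLoop : TreeProg :=
  loop .b isBit <| seq (ite .b isTrueBit (seq (push .a true) (push .c true))
    (seq (push .a false) (push .c false))) (pop .b)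

/-- Move the stack `c` to the stack `b`. -/
def saveAuxLoop : TreeProg :=
  loop .c Option.isSome <|
    seq (ite .c isTrue (push .b (some true)) (push .b (some false))) (pop .c)

/-- Duplicate the first tree of the stack `a`. -/
def dup : TreeProg :=
  seq save <| seq restoreTwiceLoop <| seq saveAuxLoop restore

/-- The contents of the stacks when they hold the given trees. -/
def ts (i : List Computability.Γ') (o : List Bool) (a b : List BTree) : ∀ k, List (Stk.Alph k) :=
  st i o (a.flatMap word) (b.flatMap fun t => t.word.reverse.map some ++ [none]) []

theorem runs_pushWord (w : List Bool) {i o a b c} :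
    StackProg.Runs (pushWord w) (st i o a b c) (st i o (w ++ a) b c) (w.length + 1) := by
  induction w with
  | nil => exact ⟨1, le_rfl, Exec.skip _⟩
  | cons x w ih => exact ih.seq (runs_push_a x)

/-- In prefix code an inner node turns one missing subtree into two, and a leaf supplies one. The
rest of the loop's run enters as the hypothesis `h`, so that for a node the runs over both subtrees
chain within one and the same loop. -/
theorem runs_saveLoop (t : BTree) {i o a b c s n}
    (h : saveLoop.Runs (st i o a (t.word.reverse.map some ++ b) c) s n) :
    saveLoop.Runs (st i o (t.word ++ a) b (true :: c)) s (7 * t.size + n) := by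
  induction t generalizing a b c n with
  | leaf =>
    refine (Runs.loop_true rfl (runs_pop_c.seq (Runs.seq (Runs.ite_false rfl (runs_push_b _))
      runs_pop_a)) h).mono ?_
    simp only [size]
    omega
  | node l r hl hr =>
    have h₁ : saveLoop.Runs (st i o (l.word ++ (r.word ++ a)) (some true :: b) (true :: true :: c))
        s (7 * l.size + (7 * r.size + n)) := hl (hr (by simpa [word] using h))
    rw [← List.append_assoc] at h₁
    refine (Runs.loop_true rfl (runs_pop_c.seq (Runs.seq (Runs.ite_true rfl
      ((runs_push_c _).seq ((runs_push_c _).seq (runs_push_b _)))) runs_pop_a)) h₁).mono ?_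
    simp only [size]
    omega

theorem runs_save {t : BTree} {i o a b} :
    save.Runs (ts i o (t :: a) b) (ts i o a (t :: b)) (7 * t.size + 3) := by
  have h := (runs_push_b none).seq ((runs_push_c true).seq (runs_saveLoop t
    (a := a.flatMap word) (i := i) (o := o)
    (b := none :: b.flatMap fun t => t.word.reverse.map some ++ [none]) (c := [])
    (Runs.loop_false rfl)))
  refine h.congr ?_ (by omega)
  simp [ts]

theorem runs_restoreLoop (w : List Bool) {i o a b c} :
    restoreLoop.Runs (st i o a (w.map some ++ none :: b) c) (st i o (w.reverse ++ a) (none :: b) c)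
      (4 * w.length + 1) := by
  induction w generalizing a with
  | nil => exact Runs.loop_false rfl
  | cons x w ih =>
    have h : StackProg.Runs (ite (Γ := Stk.Alph) .b isTrueBit (push .a true) (push .a false))
        (st i o a (some x :: (w.map some ++ none :: b)) c)
        (st i o (x :: a) (some x :: (w.map some ++ none :: b)) c) 2 := by
      cases x
      · exact Runs.ite_false rfl (runs_push_a _)
      · exact Runs.ite_true rfl (runs_push_a _)
    refine (Runs.loop_true rfl (h.seq runs_pop_b) ih).congr (by simp) ?_
    simp only [List.length_cons]
    omega

/-- Exposes the separator `none` at which the loops on the stack `b` stop. -/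
theorem ts_cons_right (i o a b) (t : BTree) :
    ts i o a (t :: b) = st i o (a.flatMap word) (t.word.reverse.map some ++ none ::
      b.flatMap fun t => t.word.reverse.map some ++ [none]) [] := by
  simp [ts]

theorem runs_restore {t : BTree} {i o a b} :
    restore.Runs (ts i o a (t :: b)) (ts i o (t :: a) b) (4 * t.size + 2) := by
  rw [ts_cons_right]
  refine ((runs_restoreLoop _).seq runs_pop_b).congr ?_ (by simp [length_word])
  simp [ts]

theorem runs_discardLoop (w : List Bool) {i o a b c} :
    StackProg.Runs (loop (Γ := Stk.Alph) .b isBit (pop .b)) (st i o a (w.map some ++ none :: b) c)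
      (st i o a (none :: b) c) (2 * w.length + 1) := by
  induction w with
  | nil => exact Runs.loop_false rfl
  | cons x w ih =>
    refine (Runs.loop_true rfl runs_pop_b ih).mono ?_
    simp only [List.length_cons]
    omega

theorem runs_discard {t : BTree} {i o a b} :
    discard.Runs (ts i o a (t :: b)) (ts i o a b) (2 * t.size + 2) := by
  rw [ts_cons_right]
  exact ((runs_discardLoop _).seq runs_pop_b).mono (by simp [length_word])

theorem runs_restoreTwiceLoop (w : List Bool) {i o a b c} :
    restoreTwiceLoop.Runs (st i o a (w.map some ++ none :: b) c)
      (st i o (w.reverse ++ a) (none :: b) (w.reverse ++ c)) (5 * w.length + 1) := by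
  induction w generalizing a c with
  | nil => exact Runs.loop_false rfl
  | cons x w ih =>
    have h : StackProg.Runs (ite (Γ := Stk.Alph) .b isTrueBit (seq (push .a true) (push .c true))
        (seq (push .a false) (push .c false)))
        (st i o a (some x :: (w.map some ++ none :: b)) c)
        (st i o (x :: a) (some x :: (w.map some ++ none :: b)) (x :: c)) 3 := by
      cases x
      · exact Runs.ite_false rfl ((runs_push_a _).seq (runs_push_c _))
      · exact Runs.ite_true rfl ((runs_push_a _).seq (runs_push_c _))
    refine (Runs.loop_true rfl (h.seq runs_pop_b) ih).congr (by simp) ?_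
    simp only [List.length_cons]
    omega

theorem runs_saveAuxLoop (w : List Bool) {i o a b} :
    saveAuxLoop.Runs (st i o a b w) (st i o a (w.reverse.map some ++ b) []) (4 * w.length + 1) := by
  induction w generalizing b with
  | nil => exact Runs.loop_false rfl
  | cons x w ih =>
    have h : StackProg.Runs (ite (Γ := Stk.Alph) .c isTrue (push .b (some true))
        (push .b (some false))) (st i o a b (x :: w)) (st i o a (some x :: b) (x :: w)) 2 := by
      cases x
      · exact Runs.ite_false rfl (runs_push_b _)
      · exact Runs.ite_true rfl (runs_push_b _)
    refine (Runs.loop_true rfl (h.seq runs_pop_c) ih).congr (by simp) ?_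
    simp only [List.length_cons]
    omega

/-- A saved word lies reversed on `b`, so moving it to `a` and `c` at once rights both copies. The
copy on `c` returns reversed to `b`, above the separator still there, and is then restored as a
second tree. -/
theorem runs_dup {t : BTree} {i o a b} :
    dup.Runs (ts i o (t :: a) b) (ts i o (t :: t :: a) b) (20 * t.size + 7) := by
  have h₁ := runs_restoreTwiceLoop t.word.reverse (i := i) (o := o) (a := a.flatMap word) (c := [])
    (b := b.flatMap fun t => t.word.reverse.map some ++ [none])
  have h₂ := runs_saveAuxLoop t.word (i := i) (o := o) (a := t.word ++ a.flatMap word)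
    (b := none :: b.flatMap fun t => t.word.reverse.map some ++ [none])
  rw [← ts_cons_right, List.reverse_reverse, List.append_nil] at h₁
  have h₃ := runs_restore (t := t) (i := i) (o := o) (a := t :: a) (b := b)
  rw [ts_cons_right] at h₃
  refine (runs_save.seq (h₁.seq (h₂.seq h₃))).mono ?_
  simp only [List.length_reverse, length_word]
  omega

/-- Replace the first two trees of the stack `a` by the tree they form, or the converse. -/
theorem runs_cons {l r : BTree} {i o a b} :
    StackProg.Runs (push (Γ := Stk.Alph) .a true) (ts i o (l :: r :: a) b)
      (ts i o (node l r :: a) b) 1 :=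
  (runs_push_a true).congr (by simp [ts, word]) le_rfl

theorem runs_uncons {l r : BTree} {i o a b} :
    StackProg.Runs (pop (Γ := Stk.Alph) .a) (ts i o (node l r :: a) b)
      (ts i o (l :: r :: a) b) 1 := by
  have h : ts i o (node l r :: a) b = st i o (true :: (l :: r :: a).flatMap word)
    (b.flatMap fun t => t.word.reverse.map some ++ [none]) [] := by simp [ts, word]
  rw [h]
  exact runs_pop_a

theorem runs_unleaf {i o a b} :
    StackProg.Runs (pop (Γ := Stk.Alph) .a) (ts i o (leaf :: a) b) (ts i o a b) 1 :=
  runs_pop_a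

theorem isTrue_leaf (i o a b) : isTrue (ts i o (leaf :: a) b .a).head? = false := rfl

theorem isTrue_node (i o a b l r) : isTrue (ts i o (node l r :: a) b .a).head? = true := rfl

end TreeProg

/-! ### Tree representations and polynomial size bounds. -/

open Turing

/-- A representation of the elements of a type by binary trees. -/
class TreeEnc (α : Type) where
  /-- The tree that represents an element. -/
  enc : α → BTree

open TreeEnc BTree

instance : TreeEnc BTree := ⟨id⟩

instance : TreeEnc Bool := ⟨fun b => if b then node leaf leaf else leaf⟩

instance {α β : Type} [TreeEnc α] [TreeEnc β] : TreeEnc (α × β) := ⟨fun p => node (enc p.1) (enc p.2)⟩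

/-- The tree that represents a list. -/
def encList {α : Type} [TreeEnc α] : List α → BTree
  | [] => leaf
  | x :: l => node (enc x) (encList l)

instance {α : Type} [TreeEnc α] : TreeEnc (List α) := ⟨encList⟩

/-- The size of the representation. -/
def tsize {α : Type} [TreeEnc α] (x : α) : ℕ := (enc x).size

section tsize

variable {α β : Type} [TreeEnc α] [TreeEnc β]

@[simp] theorem tsize_prod (x : α) (y : β) : tsize (x, y) = 1 + (tsize x + tsize y) := rfl

@[simp] theorem tsize_nil : tsize ([] : List α) = 1 := rfl

@[simp] theorem tsize_cons (x : α) (l : List α) : tsize (x :: l) = 1 + (tsize x + tsize l) := rfl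

theorem tsize_append (l l' : List α) : tsize (l ++ l') + 1 = tsize l + tsize l' := by
  induction l with
  | nil => simp; omega
  | cons x l ih => simp; omega

theorem tsize_reverse (l : List α) : tsize l.reverse = tsize l := by
  induction l with
  | nil => rfl
  | cons x l ih =>
    have := tsize_append l.reverse [x]
    simp at this ⊢
    omega

theorem List.Sublist.tsize_le {l l' : List α} (h : l.Sublist l') : tsize l ≤ tsize l' := by
  induction h with
  | slnil => rfl
  | cons x _ ih => simp; omega
  | cons_cons x _ ih => simp; omega

theorem length_lt_tsize (l : List α) : l.length < tsize l := by
  induction l with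
  | nil => simp
  | cons x l ih => simp; omega

theorem tsize_le_of_mem {x : α} {l : List α} (h : x ∈ l) : tsize x ≤ tsize l := by
  induction l with
  | nil => simp at h
  | cons y l ih =>
    rcases List.mem_cons.1 h with rfl | h
    · simp; omega
    · have := ih h
      simp; omega

theorem tsize_le_length_mul {l : List α} {B : ℕ} (h : ∀ x ∈ l, tsize x ≤ B) :
    tsize l ≤ l.length * (B + 1) + 1 := by
  induction l with
  | nil => simp
  | cons y l ih =>
    have h₁ := ih fun x hx => h x (List.mem_cons_of_mem _ hx)
    have h₂ := h y List.mem_cons_self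
    simp only [tsize_cons, List.length_cons, add_mul, one_mul]
    omega

theorem tsize_bool_le (b : Bool) : tsize b ≤ 3 := by
  cases b <;> decide

end tsize

/-- A function is bounded by a polynomial in the size of the argument. -/
def PolyBdd {α : Type} [TreeEnc α] (n : α → ℕ) : Prop :=
  ∃ P : Polynomial ℕ, ∀ x, n x ≤ P.eval (tsize x)

theorem Polynomial.eval_mono_nat (P : Polynomial ℕ) {m n : ℕ} (h : m ≤ n) :
    P.eval m ≤ P.eval n := by
  rw [Polynomial.eval_eq_sum, Polynomial.eval_eq_sum]
  exact Finset.sum_le_sum fun i _ => Nat.mul_le_mul_left _ (Nat.pow_le_pow_left h i)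

namespace PolyBdd

variable {α β : Type} [TreeEnc α] [TreeEnc β] {m n : α → ℕ}

theorem mono (h : PolyBdd n) (hmn : ∀ x, m x ≤ n x) : PolyBdd m :=
  let ⟨P, hP⟩ := h
  ⟨P, fun x => (hmn x).trans (hP x)⟩

theorem const (c : ℕ) : PolyBdd fun _ : α => c := ⟨Polynomial.C c, fun _ => by simp⟩

theorem size : PolyBdd fun x : α => tsize x := ⟨Polynomial.X, fun _ => by simp⟩

theorem add (hm : PolyBdd m) (hn : PolyBdd n) : PolyBdd fun x => m x + n x :=
  let ⟨P, hP⟩ := hm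
  let ⟨Q, hQ⟩ := hn
  ⟨P + Q, fun x => by simpa using Nat.add_le_add (hP x) (hQ x)⟩

theorem mul (hm : PolyBdd m) (hn : PolyBdd n) : PolyBdd fun x => m x * n x :=
  let ⟨P, hP⟩ := hm
  let ⟨Q, hQ⟩ := hn
  ⟨P * Q, fun x => by simpa using Nat.mul_le_mul (hP x) (hQ x)⟩

theorem eval (Q : Polynomial ℕ) (hn : PolyBdd n) : PolyBdd fun x => Q.eval (n x) :=
  let ⟨P, hP⟩ := hn
  ⟨Q.comp P, fun x => by simpa [Polynomial.eval_comp] using Q.eval_mono_nat (hP x)⟩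

theorem comp {n : β → ℕ} {f : α → β} (hn : PolyBdd n) (hf : PolyBdd fun x => tsize (f x)) :
    PolyBdd fun x => n (f x) :=
  let ⟨P, hP⟩ := hn
  (hf.eval P).mono fun x => hP (f x)

end PolyBdd

/-! ### Closure properties of polynomial-time functions. -/

open TreeProg StackProg

/-- A function is computed by a program that replaces the representation of the argument on the
stack `a` by the representation of the value, in polynomial time. -/
@[fun_prop]
def PolyTime {α β : Type} [TreeEnc α] [TreeEnc β] (f : α → β) : Prop :=
  ∃ (p : TreeProg) (n : α → ℕ), PolyBdd n ∧ (PolyBdd fun x => tsize (f x)) ∧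
    ∀ x i o a b, p.Runs (ts i o (enc x :: a) b) (ts i o (enc (f x) :: a) b) (n x)

namespace PolyTime

variable {α β γ δ σ : Type} [TreeEnc α] [TreeEnc β] [TreeEnc γ] [TreeEnc δ]

theorem size {f : α → β} (hf : PolyTime f) : PolyBdd fun x => tsize (f x) :=
  let ⟨_, _, _, h, _⟩ := hf
  h

/-- Only the trees matter: a function that merely changes the type in which a tree is read costs
nothing. This yields `cons`, `node` and the passage from parsed trees to typed data. -/
theorem of_enc {f : α → β} {g : α → γ} (hf : PolyTime f) (h : ∀ x, enc (g x) = enc (f x)) :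
    PolyTime g := by
  obtain ⟨p, n, hn, hs, hp⟩ := hf
  refine ⟨p, n, hn, hs.mono fun x => (congrArg BTree.size (h x)).le, fun x i o a b => ?_⟩
  rw [h]
  exact hp x i o a b

@[fun_prop]
theorem id : PolyTime fun x : α => x :=
  ⟨skip, _, .const 1, .size, fun _ _ _ _ _ => ⟨1, le_rfl, Exec.skip _⟩⟩

@[fun_prop]
theorem const (c : β) : PolyTime fun _ : α => c := by
  refine ⟨seq save (seq discard (pushWord (enc c).word)), _, ?_, .const _, fun x i o a b =>
    runs_save.seq (runs_discard.seq (runs_pushWord _))⟩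
  exact (((PolyBdd.const 7).mul .size).add (.const 3)).add
    ((((PolyBdd.const 2).mul .size).add (.const 2)).add (.const _))

-- The second program is polynomial in the size of the intermediate value, which is why `PolyTime`
-- also records a size bound for the value.
@[fun_prop]
theorem comp {g : β → γ} {f : α → β} (hg : PolyTime g) (hf : PolyTime f) :
    PolyTime fun x => g (f x) := by
  obtain ⟨p, n, hn, hs, hp⟩ := hf
  obtain ⟨q, m, hm, hs', hq⟩ := hg
  exact ⟨seq p q, _, hn.add (hm.comp hs), hs'.comp hs, fun x i o a b =>
    (hp x i o a b).seq (hq (f x) i o a b)⟩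

@[fun_prop]
theorem prodMk {f : α → β} {g : α → γ} (hf : PolyTime f) (hg : PolyTime g) :
    PolyTime fun x => (f x, g x) := by
  obtain ⟨p, n, hn, hs, hp⟩ := hf
  obtain ⟨q, m, hm, hs', hq⟩ := hg
  -- One copy of the argument is parked on the stack `b` while `g` runs on the other. The value of
  -- `g` comes first because that of `f` must lie on top of it when the bit `true` joins them.
  refine ⟨seq dup (seq save (seq q (seq restore (seq p (push .a true))))), _, ?_,
    (PolyBdd.const 1).add (hs.add hs'), fun x i o a b => runs_dup.seq (runs_save.seq
    ((hq x i o a _).seq (runs_restore.seq ((hp x i o _ b).seq runs_cons))))⟩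
  exact (((PolyBdd.const 20).mul .size).add (.const 7)).add
    ((((PolyBdd.const 7).mul .size).add (.const 3)).add (hm.add
      ((((PolyBdd.const 4).mul .size).add (.const 2)).add (hn.add (.const 1)))))

theorem prod_fst : PolyTime (Prod.fst : α × β → α) := by
  refine ⟨seq (pop .a) (seq save (seq save (seq discard restore))),
    fun p => 20 * tsize p + 20, ((PolyBdd.const 20).mul .size).add (.const 20),
    PolyBdd.size.mono ?_, fun x i o a b => (runs_uncons.seq
    (runs_save.seq (runs_save.seq (runs_discard.seq runs_restore)))).mono ?_⟩
  · rintro ⟨x, y⟩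
    simp only [tsize_prod]
    omega
  · obtain ⟨x, y⟩ := x
    have h₁ : (enc x).size = tsize x := rfl
    have h₂ : (enc y).size = tsize y := rfl
    simp only [tsize_prod, h₁, h₂]
    omega

theorem prod_snd : PolyTime (Prod.snd : α × β → β) := by
  refine ⟨seq (pop .a) (seq save discard),
    fun p => 20 * tsize p + 20, ((PolyBdd.const 20).mul .size).add (.const 20),
    PolyBdd.size.mono ?_, fun x i o a b => (runs_uncons.seq
    (runs_save.seq runs_discard)).mono ?_⟩
  · rintro ⟨x, y⟩
    simp only [tsize_prod]
    omega
  · obtain ⟨x, y⟩ := x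
    have h₁ : (enc x).size = tsize x := rfl
    simp only [tsize_prod, h₁]
    omega

@[fun_prop]
theorem fst {f : α → β × γ} (hf : PolyTime f) : PolyTime fun x => (f x).1 := prod_fst.comp hf

@[fun_prop]
theorem snd {f : α → β × γ} (hf : PolyTime f) : PolyTime fun x => (f x).2 := prod_snd.comp hf

@[fun_prop]
theorem cons {f : α → β} {g : α → List β} (hf : PolyTime f) (hg : PolyTime g) :
    PolyTime fun x => f x :: g x := (hf.prodMk hg).of_enc fun _ => rfl

/-- Case distinction on whether the tree that represents `h x` is a leaf. -/
theorem branch {h : α → β} {f : α → γ} {g : δ → γ} {q : α → γ} (hh : PolyTime h) (hf : PolyTime f)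
    (hg : PolyTime g) (H : ∀ x, (enc (h x) = leaf ∧ q x = f x) ∨
      ∃ y, (∃ l r, enc (h x) = node l r) ∧ enc y = node (enc (h x)) (enc x) ∧ q x = g y) :
    PolyTime q := by
  obtain ⟨p, n, hn, hs, hp⟩ := hh
  obtain ⟨p₁, n₁, hn₁, hs₁, hp₁⟩ := hf
  obtain ⟨p₂, n₂, ⟨N₂, hN₂⟩, ⟨S₂, hS₂⟩, hp₂⟩ := hg
  have hsz : ∀ {x} {y : δ}, enc y = node (enc (h x)) (enc x) → tsize y = 1 + (tsize (h x) + tsize x) :=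
    fun e => congrArg BTree.size e
  have hpair : PolyBdd fun x => 1 + (tsize (h x) + tsize x) := (PolyBdd.const 1).add (hs.add .size)
  -- The top bit tells a node from a leaf. On a node, pushing `true` joins the tree of `h x` and the
  -- argument into the tree of `y`; a leaf is a single bit and is popped.
  refine ⟨seq dup (seq p (ite .a isTrue (seq (push .a true) p₂) (seq (pop .a) p₁))),
    fun x => (20 * tsize x + 7) + (n x +
      ((1 + n₁ x) + (1 + N₂.eval (1 + (tsize (h x) + tsize x))) + 1)), ?_, ?_, fun x i o a b => ?_⟩
  · exact (((PolyBdd.const 20).mul .size).add (.const 7)).add (hn.add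
      ((((PolyBdd.const 1).add hn₁).add ((PolyBdd.const 1).add (hpair.eval N₂))).add (.const 1)))
  · refine (hs₁.add (hpair.eval S₂)).mono fun x => ?_
    rcases H x with ⟨-, hq⟩ | ⟨y, -, hy, hq⟩
    · rw [hq]
      exact Nat.le_add_right _ _
    · rw [hq, ← hsz hy]
      exact (hS₂ y).trans (Nat.le_add_left _ _)
  · refine runs_dup.seq ((hp x i o _ b).seq ?_)
    rcases H x with ⟨hl, hq⟩ | ⟨y, ⟨l, r, hlr⟩, hy, hq⟩
    · rw [hl, hq]
      refine (Runs.ite_false (isTrue_leaf _ _ _ _) (runs_unleaf.seq (hp₁ x i o a b))).mono ?_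
      omega
    · have h₂ := (runs_cons (l := enc (h x)) (r := enc x) (i := i) (o := o) (a := a) (b := b))
      rw [← hy] at h₂
      rw [hq]
      refine (Runs.ite_true (by rw [hlr]; exact isTrue_node _ _ _ _ _ _)
        (h₂.seq (hp₂ y i o a b))).mono ?_
      have := hN₂ y
      rw [hsz hy] at this
      omega

@[fun_prop]
theorem ite {c : α → Bool} {f g : α → β} (hc : PolyTime c) (hf : PolyTime f) (hg : PolyTime g) :
    PolyTime fun x => if c x then f x else g x :=
  branch hc hg (g := fun p : Bool × α => f p.2) (hf.comp prod_snd) fun x => by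
    cases h : c x
    · exact .inl ⟨rfl, by simp⟩
    · exact .inr ⟨(true, x), ⟨_, _, rfl⟩, rfl, by simp⟩

theorem list_casesOn {l : α → List β} {f : α → γ} {g : α → β → List β → γ} (hl : PolyTime l)
    (hf : PolyTime f) (hg : PolyTime fun p : (β × List β) × α => g p.2 p.1.1 p.1.2) :
    PolyTime fun x => match l x with
      | [] => f x
      | y :: ys => g x y ys :=
  branch hl hf hg fun x => by
    rcases h : l x with _ | ⟨y, ys⟩
    · exact .inl ⟨rfl, rfl⟩
    · exact .inr ⟨((y, ys), x), ⟨_, _, rfl⟩, rfl, rfl⟩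

/-- The program that runs `p` on the pair of the first element of a list and an accumulator, for
all elements of the list; `r` rearranges the list and the accumulator. -/
def foldProg (r p : TreeProg) : TreeProg :=
  seq (pop .a) <| seq (loop .a isTrue <| seq (push .a true) <| seq r <| seq (pop .a) <|
    seq save <| seq p restore) (pop .a)

/-- Left fold with accumulators of polynomial size. -/
theorem foldl_aux {l : γ → List α} {s : γ → σ} {f : σ → α → σ} [TreeEnc σ] (hl : PolyTime l)
    (hs : PolyTime s) (hf : PolyTime fun p : α × σ => f p.2 p.1)
    (hb : ∃ n : γ → ℕ, PolyBdd n ∧ ∀ c w, w <+: l c → tsize (w.foldl f (s c)) ≤ n c) :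
    PolyTime fun c => (l c).foldl f (s c) := by
  obtain ⟨B, hB, hB'⟩ := hb
  obtain ⟨p₀, n₀, hn₀, hs₀, hp₀⟩ := hl.prodMk hs
  have hr : PolyTime fun p : (α × List α) × σ => (p.1.2, (p.1.1, p.2)) := by fun_prop
  obtain ⟨r, m, ⟨M, hM⟩, -, hr⟩ := hr
  obtain ⟨p, n, ⟨N, hN⟩, -, hp⟩ := hf
  -- The bit `true` makes `((x, xs), y)` out of the list and the accumulator, and `r` turns it into
  -- `(xs, (x, y))`. The rest `xs` waits on the stack `b` while the step runs.
  have hbody : ∀ x xs (y : σ) (L S : ℕ), 1 + (tsize x + tsize xs) ≤ L → tsize y ≤ S →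
      ∀ i o a b, StackProg.Runs (seq (push (Γ := Stk.Alph) .a true) <| seq r <| seq (pop .a) <|
        seq save <| seq p restore) (ts i o (enc (x :: xs) :: enc y :: a) b)
      (ts i o (enc xs :: enc (f y x) :: a) b)
      (M.eval (1 + (L + S)) + N.eval (1 + (L + S)) + 11 * L + 7) := by
    intro x xs y L S hL hS i o a b
    refine (runs_cons.seq ((hr ((x, xs), y) i o a b).seq (runs_uncons.seq (runs_save.seq
      ((hp (x, y) i o a _).seq runs_restore))))).mono ?_
    have h₁ := (hM ((x, xs), y)).trans (M.eval_mono_nat (n := 1 + (L + S)) (by simp; omega))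
    have h₂ := (hN (x, y)).trans (N.eval_mono_nat (n := 1 + (L + S)) (by simp; omega))
    have h₃ : (enc xs).size = tsize xs := rfl
    simp only [h₃]
    omega
  -- `L` bounds the remaining list and `S` all accumulators still to come. The empty prefix bounds
  -- the current accumulator, and the prefixes starting with `x` give the hypothesis for the tail.
  have hloop : ∀ (L S : ℕ) (w : List α) (y : σ), tsize w ≤ L →
      (∀ v, v <+: w → tsize (v.foldl f y) ≤ S) →
      ∀ i o a b, StackProg.Runs (loop (Γ := Stk.Alph) .a isTrue <| seq (push .a true) <| seq r <|
        seq (pop .a) <| seq save <| seq p restore) (ts i o (enc w :: enc y :: a) b)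
      (ts i o (leaf :: enc (w.foldl f y) :: a) b)
      (w.length * (M.eval (1 + (L + S)) + N.eval (1 + (L + S)) + 11 * L + 8) + 1) := by
    intro L S w
    induction w with
    | nil =>
      intro y _ _ i o a b
      exact (Runs.loop_false (isTrue_leaf _ _ _ _)).mono (by simp)
    | cons x w ih =>
      intro y hL hS i o a b
      refine (Runs.loop_true (isTrue_node _ _ _ _ _ _) (hbody x w y L S hL (hS [] (by simp)) i o a b)
        (ih (f y x) (le_trans (by simp; omega) hL)
          (fun v hv => hS (x :: v) (List.cons_prefix_cons.2 ⟨rfl, hv⟩)) i o a b)).mono ?_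
      rw [List.length_cons, add_mul]
      omega
  refine ⟨seq p₀ (foldProg r p), fun c => n₀ c + (1 + ((tsize (l c) * (M.eval (1 + (tsize (l c) +
    B c)) + N.eval (1 + (tsize (l c) + B c)) + 11 * tsize (l c) + 8) + 1) + 1)), ?_,
    hB.mono fun c => hB' c _ List.prefix_rfl, fun c i o a b => ?_⟩
  · have h : PolyBdd fun c => 1 + (tsize (l c) + B c) := (PolyBdd.const 1).add (hl.size.add hB)
    exact hn₀.add ((PolyBdd.const 1).add (((hl.size.mul ((((h.eval M).add (h.eval N)).add
      ((PolyBdd.const 11).mul hl.size)).add (.const 8))).add (.const 1)).add (.const 1)))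
  · refine ((hp₀ c i o a b).seq (runs_uncons.seq ((hloop (tsize (l c)) (B c) (l c) (s c) le_rfl
      (hB' c) i o a b).seq runs_unleaf))).mono ?_
    have := Nat.mul_le_mul_right (M.eval (1 + (tsize (l c) + B c)) +
      N.eval (1 + (tsize (l c) + B c)) + 11 * tsize (l c) + 8) (length_lt_tsize (l c)).le
    beta_reduce
    omega

/-- Left fold with accumulators of polynomial size, in which the step depends on the context. -/
theorem foldl {l : γ → List α} {s : γ → σ} {f : γ → σ → α → σ} [TreeEnc σ] (hl : PolyTime l)
    (hs : PolyTime s) (hf : PolyTime fun p : γ × σ × α => f p.1 p.2.1 p.2.2)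
    (hb : ∃ n : γ → ℕ, PolyBdd n ∧ ∀ c w, w <+: l c → tsize (w.foldl (f c) (s c)) ≤ n c) :
    PolyTime fun c => (l c).foldl (f c) (s c) := by
  -- The context travels unchanged as a second component of the accumulator.
  have key : ∀ c (w : List α) y, w.foldl (fun (q : σ × γ) x => (f q.2 q.1 x, q.2)) (y, c) =
      (w.foldl (f c) y, c) := by
    intro c w
    induction w with
    | nil => intro y; rfl
    | cons x w ih => intro y; exact ih _
  have h : PolyTime fun c => (l c).foldl (fun (q : σ × γ) x => (f q.2 q.1 x, q.2)) (s c, c) := by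
    refine foldl_aux hl (hs.prodMk id) ?_ ?_
    · exact (hf.comp (f := fun p : α × σ × γ => (p.2.2, p.2.1, p.1)) (by fun_prop)).prodMk
        (by fun_prop)
    · obtain ⟨n, hn, h⟩ := hb
      refine ⟨fun c => 1 + (n c + tsize c), (PolyBdd.const 1).add (hn.add .size),
        fun c w hw => ?_⟩
      have := h c w hw
      rw [key, tsize_prod]
      beta_reduce
      omega
  simp only [key] at h
  exact h.fst

@[fun_prop]
theorem reverse {l : γ → List α} (hl : PolyTime l) : PolyTime fun c => (l c).reverse := by
  have key : ∀ w v : List α, w.foldl (fun s x => x :: s) v = w.reverse ++ v := by simp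
  have h : PolyTime fun c => (l c).foldl (fun s x => x :: s) [] := by
    refine foldl_aux hl (const _) (prod_fst.cons prod_snd) ⟨_, hl.size, fun c w hw => ?_⟩
    rw [key, List.append_nil, tsize_reverse]
    exact hw.sublist.tsize_le
  simpa only [key, List.append_nil] using h

/-- Right fold with accumulators of polynomial size. -/
theorem foldr {l : γ → List α} {s : γ → σ} {f : γ → α → σ → σ} [TreeEnc σ] (hl : PolyTime l)
    (hs : PolyTime s) (hf : PolyTime fun p : γ × α × σ => f p.1 p.2.1 p.2.2)
    (hb : ∃ n : γ → ℕ, PolyBdd n ∧ ∀ c w, w <:+ l c → tsize (w.foldr (f c) (s c)) ≤ n c) :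
    PolyTime fun c => (l c).foldr (f c) (s c) := by
  obtain ⟨n, hn, h⟩ := hb
  -- A right fold is a left fold over the reversed list, whose prefixes are the reversed suffixes of
  -- `l c`.
  have := foldl hl.reverse hs (f := fun c y x => f c x y)
    (hf.comp (f := fun p : γ × σ × α => (p.1, p.2.2, p.2.1)) (by fun_prop)) ⟨n, hn, fun c w hw => by
      rw [← List.foldr_reverse]
      exact h c _ (List.reverse_prefix.1 (by rwa [List.reverse_reverse]))⟩
  simpa only [List.foldl_reverse] using this

end PolyTime

/-! ### List and Boolean operations in polynomial time. -/

open TreeEnc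

namespace PolyTime

variable {α β γ : Type} [TreeEnc α] [TreeEnc β] [TreeEnc γ]

theorem map {l : γ → List α} {f : γ → α → β} (hl : PolyTime l)
    (hf : PolyTime fun p : γ × α => f p.1 p.2) : PolyTime fun c => (l c).map (f c) := by
  have key : ∀ c (w : List α), w.foldr (fun x v => f c x :: v) [] = w.map (f c) := by simp
  obtain ⟨S, hS⟩ := hf.size
  have h : PolyTime fun c => (l c).foldr (fun x v => f c x :: v) [] := by
    refine foldr (f := fun c x v => f c x :: v) hl (const _) ?_
      ⟨fun c => tsize (l c) * (S.eval (1 + (tsize c + tsize (l c))) + 1) + 1, ?_, fun c w hw => ?_⟩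
    · exact cons (hf.comp (f := fun p : γ × α × List β => (p.1, p.2.1)) (by fun_prop))
        (by fun_prop)
    · exact (hl.size.mul ((((PolyBdd.const 1).add (PolyBdd.size.add hl.size)).eval S).add
        (.const 1))).add (.const 1)
    · rw [key]
      refine (tsize_le_length_mul (B := S.eval (1 + (tsize c + tsize (l c)))) fun y hy => ?_).trans
        ?_
      · obtain ⟨x, hx, rfl⟩ := List.mem_map.1 hy
        refine (hS (c, x)).trans (S.eval_mono_nat ?_)
        have := tsize_le_of_mem (hw.subset hx)
        rw [tsize_prod]
        omega
      · rw [List.length_map]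
        have := (length_lt_tsize w).le.trans hw.sublist.tsize_le
        exact Nat.add_le_add_right (Nat.mul_le_mul_right _ this) _
  simpa only [key] using h

theorem filter {l : γ → List α} {q : γ → α → Bool} (hl : PolyTime l)
    (hq : PolyTime fun p : γ × α => q p.1 p.2) : PolyTime fun c => (l c).filter (q c) := by
  have key : ∀ c (w : List α), w.foldr (fun x v => if q c x then x :: v else v) [] =
      w.filter (q c) := by
    intro c w
    induction w with
    | nil => rfl
    | cons x w ih => rw [List.foldr_cons, ih, List.filter_cons]
  have hq' := hq.comp (f := fun p : γ × α × List α => (p.1, p.2.1)) (by fun_prop)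
  have h : PolyTime fun c => (l c).foldr (fun x v => if q c x then x :: v else v) [] := by
    refine foldr (f := fun c x v => if q c x then x :: v else v) hl (const _) (by fun_prop)
      ⟨_, hl.size, fun c w hw => ?_⟩
    rw [key]
    exact (List.filter_sublist.trans hw.sublist).tsize_le
  simpa only [key] using h

theorem takeWhile {l : γ → List α} {q : γ → α → Bool} (hl : PolyTime l)
    (hq : PolyTime fun p : γ × α => q p.1 p.2) : PolyTime fun c => (l c).takeWhile (q c) := by
  have key : ∀ c (w : List α), w.foldr (fun x v => if q c x then x :: v else []) [] =
      w.takeWhile (q c) := by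
    intro c w
    induction w with
    | nil => rfl
    | cons x w ih => rw [List.foldr_cons, ih, List.takeWhile_cons]
  have hq' := hq.comp (f := fun p : γ × α × List α => (p.1, p.2.1)) (by fun_prop)
  have h : PolyTime fun c => (l c).foldr (fun x v => if q c x then x :: v else []) [] := by
    refine foldr (f := fun c x v => if q c x then x :: v else []) hl (const _) (by fun_prop)
      ⟨_, hl.size, fun c w hw => ?_⟩
    rw [key]
    exact ((List.takeWhile_prefix _).sublist.trans hw.sublist).tsize_le
  simpa only [key] using h

theorem any {l : γ → List α} {q : γ → α → Bool} (hl : PolyTime l)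
    (hq : PolyTime fun p : γ × α => q p.1 p.2) : PolyTime fun c => (l c).any (q c) := by
  have key : ∀ c (w : List α), w.foldr (fun x v => if q c x then true else v) false =
      w.any (q c) := by
    intro c w
    induction w with
    | nil => rfl
    | cons x w ih =>
      rw [List.foldr_cons, ih, List.any_cons]
      cases q c x <;> rfl
  have hq' := hq.comp (f := fun p : γ × α × Bool => (p.1, p.2.1)) (by fun_prop)
  have h : PolyTime fun c => (l c).foldr (fun x v => if q c x then true else v) false :=
    foldr (f := fun c x v => if q c x then true else v) hl (const _) (by fun_prop)
      ⟨_, .const 3, fun c w hw => tsize_bool_le _⟩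
  simpa only [key] using h

@[fun_prop]
theorem append {l l' : γ → List α} (hl : PolyTime l) (hl' : PolyTime l') :
    PolyTime fun c => l c ++ l' c := by
  have key : ∀ w v : List α, w.foldr (fun x v => x :: v) v = w ++ v := by simp
  have h : PolyTime fun c => (l c).foldr (fun x v => x :: v) (l' c) := by
    refine foldr (f := fun _ x v => x :: v) hl hl' (by fun_prop)
      ⟨_, hl.size.add hl'.size, fun c w hw => ?_⟩
    have h₁ := tsize_append w (l' c)
    have h₂ := hw.sublist.tsize_le
    rw [key]
    omega
  simpa only [key] using h

theorem tsize_flatten_le (w : List (List α)) : tsize w.flatten ≤ tsize w := by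
  induction w with
  | nil => rfl
  | cons x w ih =>
    have h₁ := tsize_append x w.flatten
    rw [List.flatten_cons, tsize_cons]
    omega

@[fun_prop]
theorem flatten {l : γ → List (List α)} (hl : PolyTime l) : PolyTime fun c => (l c).flatten := by
  have key : ∀ w : List (List α), w.foldr (fun x v => x ++ v) [] = w.flatten := by
    intro w
    induction w with
    | nil => rfl
    | cons x w ih => rw [List.foldr_cons, ih, List.flatten_cons]
  have h : PolyTime fun c => (l c).foldr (fun x v => x ++ v) [] := by
    refine foldr (f := fun _ x v => x ++ v) hl (const _) (by fun_prop)
      ⟨_, hl.size, fun c w hw => ?_⟩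
    rw [key]
    exact (tsize_flatten_le _).trans hw.sublist.tsize_le
  simpa only [key] using h

theorem flatMap {l : γ → List α} {f : γ → α → List β} (hl : PolyTime l)
    (hf : PolyTime fun p : γ × α => f p.1 p.2) : PolyTime fun c => (l c).flatMap (f c) := by
  simp only [List.flatMap_def]
  exact (map hl hf).flatten

@[fun_prop]
theorem tail {l : γ → List α} (hl : PolyTime l) : PolyTime fun c => (l c).tail := by
  have h := list_casesOn (f := fun _ => []) (g := fun _ _ w => w) hl (by fun_prop) (by fun_prop)
  convert h using 2 with c
  cases l c <;> rfl

@[fun_prop]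
theorem headD {l : γ → List α} {d : γ → α} (hl : PolyTime l) (hd : PolyTime d) :
    PolyTime fun c => (l c).headD (d c) := by
  have h := list_casesOn (f := d) (g := fun _ x _ => x) hl hd (by fun_prop)
  convert h using 2 with c
  cases l c <;> rfl

@[fun_prop]
theorem not {p : γ → Bool} (hp : PolyTime p) : PolyTime fun c => !p c := by
  have h : PolyTime fun c => if p c then false else true := by fun_prop
  convert h using 2 with c
  cases p c <;> rfl

@[fun_prop]
theorem and {p q : γ → Bool} (hp : PolyTime p) (hq : PolyTime q) : PolyTime fun c => p c && q c := by
  have h : PolyTime fun c => if p c then q c else false := by fun_prop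
  convert h using 2 with c
  cases p c <;> rfl

@[fun_prop]
theorem or {p q : γ → Bool} (hp : PolyTime p) (hq : PolyTime q) : PolyTime fun c => p c || q c := by
  have h : PolyTime fun c => if p c then true else q c := by fun_prop
  convert h using 2 with c
  cases p c <;> rfl

@[fun_prop]
theorem xor {p q : γ → Bool} (hp : PolyTime p) (hq : PolyTime q) :
    PolyTime fun c => (p c).xor (q c) := by
  have h : PolyTime fun c => if p c then !q c else q c := by fun_prop
  convert h using 2 with c
  cases p c <;> simp

end PolyTime

/-! ### Arithmetic of binary numbers, the least significant digit first -/

namespace Binary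

/-- The number with the given binary digits. -/
def val : List Bool → ℕ
  | [] => 0
  | b :: l => b.toNat + 2 * val l

/-- One step of the addition: the state consists of the remaining digits of the second number,
the carry and the digits of the sum so far, in reverse. -/
def addStep (s : List Bool × Bool × List Bool) (b : Bool) : List Bool × Bool × List Bool :=
  (s.1.tail, (b && s.1.headD false) || (s.2.1 && (b.xor (s.1.headD false))),
    (b.xor (s.1.headD false)).xor s.2.1 :: s.2.2)

/-- A number with additional leading zeros, as many as `y` has digits. -/
def pad (x y : List Bool) : List Bool := x ++ y.map fun _ => false

/-- Addition. -/
def add (x y : List Bool) : List Bool :=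
  let s := (pad x y).foldl addStep (y, false, [])
  (s.2.1 :: s.2.2).reverse

/-- One step of the comparison. -/
def leStep (s : List Bool × Bool) (b : Bool) : List Bool × Bool :=
  (s.1.tail, if b.xor (s.1.headD false) then !b else s.2)

/-- Comparison. -/
def le (x y : List Bool) : Bool :=
  ((pad x y).foldl leStep (y, true)).2

/-- Equality of the numbers. -/
def eq (x y : List Bool) : Bool := le x y && le y x

/-- The number of elements of a list. -/
def count {α : Type} (l : List α) : List Bool := l.foldl (fun n _ => add n [true]) []

theorem val_append (x y : List Bool) : val (x ++ y) = val x + 2 ^ x.length * val y := by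
  induction x with
  | nil => simp [val]
  | cons b x ih => simp only [List.cons_append, val, ih, List.length_cons]; ring

theorem val_pad (x y : List Bool) : val (pad x y) = val x := by
  have h : val (y.map fun _ => false) = 0 := by
    induction y with
    | nil => rfl
    | cons b y ih => rw [List.map_cons, val, ih]; rfl
  rw [pad, val_append, h]
  simp

theorem length_pad (x y : List Bool) : (pad x y).length = x.length + y.length := by
  simp [pad]

theorem foldl_addStep_fst (x : List Bool) (s) :
    (x.foldl addStep s).1 = s.1.drop x.length := by
  induction x generalizing s with
  | nil => rfl
  | cons b x ih => simp [ih, addStep]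

theorem length_foldl_addStep (x : List Bool) (s) :
    (x.foldl addStep s).2.2.length = s.2.2.length + x.length := by
  induction x generalizing s with
  | nil => rfl
  | cons b x ih => simp [ih, addStep]; omega

/-- Loop invariant of schoolbook addition: the digits written, plus the carry and the unread digits
shifted by their number, keep representing the sum. -/
theorem val_foldl_addStep (x : List Bool) (s) :
    val (x.foldl addStep s).2.2.reverse + 2 ^ (s.2.2.length + x.length) *
      ((x.foldl addStep s).2.1.toNat + val (x.foldl addStep s).1) =
    val s.2.2.reverse + 2 ^ s.2.2.length * (val x + val s.1 + s.2.1.toNat) := by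
  induction x generalizing s with
  | nil => simp [val]; ring
  | cons b x ih =>
    obtain ⟨y, c, w⟩ := s
    have h := ih (addStep (y, c, w) b)
    have hlen : (addStep (y, c, w) b).2.2.length + x.length = w.length + (x.length + 1) := by
      simp [addStep]; omega
    rw [hlen] at h
    rw [List.foldl_cons, List.length_cons]
    dsimp only at h ⊢
    rw [h]
    have hy : val y = (y.headD false).toNat + 2 * val y.tail := by
      cases y <;> rfl
    rw [hy]
    simp only [addStep, List.reverse_cons, val_append, List.length_reverse, List.length_cons, val]
    cases b <;> cases c <;> cases y.headD false <;> simp <;> ring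

theorem val_add (x y : List Bool) : val (add x y) = val x + val y := by
  have h := val_foldl_addStep (pad x y) (y, false, [])
  have h₁ := length_foldl_addStep (pad x y) (y, false, [])
  rw [foldl_addStep_fst, val_pad, length_pad] at h
  rw [length_pad] at h₁
  -- The padded first summand is at least as long as `y`, so no digit of `y` is left over.
  simp only [List.drop_eq_nil_of_le (Nat.le_add_left y.length x.length)] at h
  simp only [add, List.reverse_cons, val_append, List.length_reverse, h₁]
  simpa [val] using h

/-- Leading zeros are never trimmed, but lengths grow only additively, so iterated sums stay of
polynomial length. -/
theorem length_add (x y : List Bool) : (add x y).length = x.length + y.length + 1 := by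
  have h := length_foldl_addStep (pad x y) (y, false, [])
  rw [length_pad] at h
  simpa [add] using h

/-- Digits arrive least significant first, so each differing digit overrides the verdict so far. The
length hypothesis ensures that all of `s.1` is read. -/
theorem foldl_leStep_snd (x : List Bool) (s) (h : s.1.length ≤ x.length) :
    (x.foldl leStep s).2 = true ↔ val x < val s.1 ∨ val x = val s.1 ∧ s.2 = true := by
  induction x generalizing s with
  | nil => simp [List.length_eq_zero_iff.1 (Nat.le_zero.1 h), val]
  | cons b x ih =>
    obtain ⟨y, c⟩ := s
    rw [List.foldl_cons, ih _ (by simpa [leStep] using h)]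
    have hy : val y = (y.headD false).toNat + 2 * val y.tail := by
      cases y <;> rfl
    dsimp only
    rw [hy]
    simp only [leStep, val]
    cases b <;> cases y.headD false <;> cases c <;> simp <;> omega

theorem le_iff (x y : List Bool) : le x y = true ↔ val x ≤ val y := by
  rw [le, foldl_leStep_snd _ _ (by simp [length_pad]), val_pad]
  simp only [and_true]
  omega

theorem eq_iff (x y : List Bool) : eq x y = true ↔ val x = val y := by
  rw [eq, Bool.and_eq_true, le_iff, le_iff]
  omega

theorem val_count {α : Type} (l : List α) : val (count l) = l.length := by
  have h : ∀ n, val (l.foldl (fun n _ => add n [true]) n) = val n + l.length := by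
    induction l with
    | nil => simp
    | cons x l ih => intro n; simp [ih, val_add, val]; omega
  simpa [val, count] using h []

theorem length_count {α : Type} (l : List α) : (count l).length = 2 * l.length := by
  have h : ∀ n, (l.foldl (fun n _ => add n [true]) n).length = n.length + 2 * l.length := by
    induction l with
    | nil => simp
    | cons x l ih => intro n; simp [ih, length_add]; omega
  simpa [count] using h []

theorem tsize_le (x : List Bool) : tsize x ≤ x.length * 4 + 1 :=
  tsize_le_length_mul fun b _ => tsize_bool_le b

end Binary

/-! ### Binary arithmetic in polynomial time. -/

namespace PolyTime

open Binary

variable {α β γ : Type} [TreeEnc α] [TreeEnc β] [TreeEnc γ]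

@[fun_prop]
theorem pad {x y : γ → List Bool} (hx : PolyTime x) (hy : PolyTime y) :
    PolyTime fun c => Binary.pad (x c) (y c) := by
  have h := map (f := fun _ _ => false) hy (by fun_prop)
  exact hx.append h

@[fun_prop]
theorem add {x y : γ → List Bool} (hx : PolyTime x) (hy : PolyTime y) :
    PolyTime fun c => Binary.add (x c) (y c) := by
  have h : PolyTime fun c => (Binary.pad (x c) (y c)).foldl addStep (y c, false, []) := by
    refine foldl (f := fun _ => addStep) (hx.pad hy) (by fun_prop) ?_
      ⟨fun c => tsize (Binary.pad (x c) (y c)) * 4 + tsize (y c) + 6, ?_, fun c w hw => ?_⟩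
    · unfold addStep
      fun_prop
    · exact (((hx.pad hy).size.mul (.const 4)).add hy.size).add (.const 6)
    · have h₁ := foldl_addStep_fst w (y c, false, [])
      have h₂ := length_foldl_addStep w (y c, false, [])
      generalize w.foldl addStep (y c, false, []) = r at h₁ h₂ ⊢
      obtain ⟨u, v, z⟩ := r
      dsimp only at h₁ h₂
      have h₃ : tsize u ≤ tsize (y c) := by
        rw [h₁]
        exact (List.drop_sublist _ _).tsize_le
      have h₄ : z.length = w.length := by simpa using h₂
      have h₅ := Binary.tsize_le z
      have h₆ := (length_lt_tsize w).le.trans hw.sublist.tsize_le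
      have h₇ := tsize_bool_le v
      simp only [tsize_prod]
      omega
  exact (h.snd.fst.cons h.snd.snd).reverse

@[fun_prop]
theorem le {x y : γ → List Bool} (hx : PolyTime x) (hy : PolyTime y) :
    PolyTime fun c => Binary.le (x c) (y c) := by
  have h : PolyTime fun c => (Binary.pad (x c) (y c)).foldl leStep (y c, true) := by
    refine foldl (f := fun _ => leStep) (hx.pad hy) (by fun_prop) ?_
      ⟨fun c => tsize (y c) + 4, hy.size.add (.const 4), fun c w hw => ?_⟩
    · unfold leStep
      fun_prop
    · have key : ∀ s, (w.foldl leStep s).1 = s.1.drop w.length := by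
        clear hw
        induction w with
        | nil => intro s; rfl
        | cons b w ih => intro s; simp [ih, leStep]
      have h₁ := key (y c, true)
      generalize w.foldl leStep (y c, true) = r at h₁ ⊢
      obtain ⟨u, v⟩ := r
      dsimp only at h₁
      have h₃ : tsize u ≤ tsize (y c) := by
        rw [h₁]
        exact (List.drop_sublist _ _).tsize_le
      have h₇ := tsize_bool_le v
      simp only [tsize_prod]
      omega
  exact h.snd

@[fun_prop]
theorem eq {x y : γ → List Bool} (hx : PolyTime x) (hy : PolyTime y) :
    PolyTime fun c => Binary.eq (x c) (y c) := (hx.le hy).and (hy.le hx)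

@[fun_prop]
theorem count {l : γ → List α} (hl : PolyTime l) : PolyTime fun c => Binary.count (l c) := by
  refine foldl (f := fun _ n _ => Binary.add n [true]) hl (const _) (by fun_prop)
    ⟨fun c => 2 * tsize (l c) * 4 + 1, ?_, fun c w hw => ?_⟩
  · exact (((PolyBdd.const 2).mul hl.size).mul (.const 4)).add (.const 1)
  · have h₁ := Binary.tsize_le (Binary.count w)
    rw [length_count] at h₁
    have h₂ := (length_lt_tsize w).le.trans hw.sublist.tsize_le
    refine le_trans (b := 2 * w.length * 4 + 1) h₁ ?_
    beta_reduce
    omega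

end PolyTime

open TreeEnc

/-! ### The Pareto front of the pairs of a kept weight and a deletion cost -/

namespace Knapsack

open Binary

/-- A pair of a weight and a cost is at most another one in both components. -/
def dom (p q : List Bool × List Bool) : Bool := le p.1 q.1 && le p.2 q.2

/-- Insert a pair into a list of pairs unless it is dominated, and remove what it dominates. -/
def insert (p : List Bool × List Bool) (L : List (List Bool × List Bool)) :
    List (List Bool × List Bool) :=
  if L.any fun q => dom q p then L else p :: L.filter fun q => !dom p q

/-- Remove dominated pairs. -/
def prune (L : List (List Bool × List Bool)) : List (List Bool × List Bool) := L.foldr insert []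

/-- Delete or keep one item. The weight of an item is the length of its first component, its cost
is the second component. -/
def extend {α : Type} (x : List α × List Bool) (L : List (List Bool × List Bool)) :
    List (List Bool × List Bool) :=
  prune (L.map (fun p => (p.1, add p.2 x.2)) ++ L.map fun p => (add p.1 (count x.1), p.2))

/-- The Pareto front of a list of items. -/
def front {α : Type} (l : List (List α × List Bool)) : List (List Bool × List Bool) :=
  l.foldr extend [([], [])]

theorem dom_iff {p q : List Bool × List Bool} :
    dom p q = true ↔ val p.1 ≤ val q.1 ∧ val p.2 ≤ val q.2 := by
  simp [dom, le_iff]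

theorem mem_of_mem_insert {p q : List Bool × List Bool} {L : List (List Bool × List Bool)}
    (h : q ∈ insert p L) : q = p ∨ q ∈ L := by
  unfold insert at h
  split at h
  · exact .inr h
  · rcases List.mem_cons.1 h with h | h
    · exact .inl h
    · exact .inr (List.mem_filter.1 h).1

theorem tsize_insert_le (p : List Bool × List Bool) (L : List (List Bool × List Bool)) :
    tsize (insert p L) ≤ 1 + (tsize p + tsize L) := by
  unfold insert
  split
  · omega
  · have := (List.filter_sublist (p := fun q => !dom p q) (l := L)).tsize_le
    rw [tsize_cons]
    omega

theorem mem_of_mem_prune {q : List Bool × List Bool} {L : List (List Bool × List Bool)}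
    (h : q ∈ prune L) : q ∈ L := by
  induction L with
  | nil => exact h
  | cons p L ih =>
    rcases mem_of_mem_insert h with rfl | h
    · exact List.mem_cons_self
    · exact List.mem_cons_of_mem _ (ih h)

/-- Domination is transitive: if inserting `p` removes `r`, then `p` takes over whatever `r`
dominated. -/
theorem exists_dom_insert {p q : List Bool × List Bool} {L : List (List Bool × List Bool)}
    (h : q = p ∨ ∃ r ∈ L, dom r q = true) : ∃ r ∈ insert p L, dom r q = true := by
  unfold insert
  split
  case isTrue hp =>
    rcases h with rfl | h
    · exact List.any_eq_true.1 hp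
    · exact h
  case isFalse hp =>
    rcases h with rfl | ⟨r, hr, hrq⟩
    · exact ⟨q, List.mem_cons_self, dom_iff.2 ⟨le_rfl, le_rfl⟩⟩
    · cases hpr : dom p r
      · exact ⟨r, List.mem_cons_of_mem _ (List.mem_filter.2 ⟨hr, by simp [hpr]⟩), hrq⟩
      · rw [dom_iff] at hpr hrq
        exact ⟨p, List.mem_cons_self, dom_iff.2 ⟨hpr.1.trans hrq.1, hpr.2.trans hrq.2⟩⟩

theorem exists_dom_prune {q : List Bool × List Bool} {L : List (List Bool × List Bool)}
    (h : q ∈ L) : ∃ r ∈ prune L, dom r q = true := by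
  induction L with
  | nil => simp at h
  | cons p L ih =>
    apply exists_dom_insert
    rcases List.mem_cons.1 h with h | h
    · exact .inl h
    · exact .inr (ih h)

theorem pairwise_prune (L : List (List Bool × List Bool)) :
    (prune L).Pairwise fun p q => dom p q = false ∧ dom q p = false := by
  induction L with
  | nil => exact List.Pairwise.nil
  | cons p L ih =>
    change (insert p (prune L)).Pairwise _
    unfold insert
    split
    case isTrue => exact ih
    case isFalse hp =>
      refine List.pairwise_cons.2 ⟨fun q hq => ?_, ih.filter _⟩
      obtain ⟨hq, hpq⟩ := List.mem_filter.1 hq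
      refine ⟨by simpa using hpq, ?_⟩
      by_contra h
      exact hp (List.any_eq_true.2 ⟨q, hq, by simpa using h⟩)

/-- Of two pairs with equal weight one dominates the other, so in a pruned list the weights are
distinct natural numbers up to `W`. The size of the costs plays no role. -/
theorem length_prune_le {L : List (List Bool × List Bool)} {W : ℕ}
    (h : ∀ p ∈ L, val p.1 ≤ W) : (prune L).length ≤ W + 1 := by
  have hnd : ((prune L).map fun p => val p.1).Nodup := by
    refine List.pairwise_map.2 ((pairwise_prune L).imp ?_)
    rintro p q ⟨h₁, h₂⟩ he
    rw [← Bool.not_eq_true, dom_iff] at h₁ h₂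
    omega
  have hsub : ((prune L).map fun p => val p.1).toFinset ⊆ Finset.range (W + 1) := by
    intro x hx
    obtain ⟨p, hp, rfl⟩ := List.mem_map.1 (List.mem_toFinset.1 hx)
    exact Finset.mem_range_succ_iff.2 (h p (mem_of_mem_prune hp))
  have := Finset.card_le_card hsub
  rwa [List.toFinset_card_of_nodup hnd, List.length_map, Finset.card_range] at this

theorem mem_of_mem_extend {α : Type} {x : List α × List Bool} {L : List (List Bool × List Bool)}
    {q : List Bool × List Bool} (h : q ∈ extend x L) :
    ∃ p ∈ L, q = (p.1, add p.2 x.2) ∨ q = (add p.1 (count x.1), p.2) := by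
  rcases List.mem_append.1 (mem_of_mem_prune h) with h | h
  · obtain ⟨p, hp, rfl⟩ := List.mem_map.1 h
    exact ⟨p, hp, .inl rfl⟩
  · obtain ⟨p, hp, rfl⟩ := List.mem_map.1 h
    exact ⟨p, hp, .inr rfl⟩

/-- The weight of an item is given in unary, as a list, so the total weight is at most the size of
the item list. Digit counts grow by a linear amount per item. -/
theorem bounds_of_mem_front {α : Type} [TreeEnc α] {l : List (List α × List Bool)}
    {p : List Bool × List Bool} (h : p ∈ front l) :
    val p.1 ≤ tsize l ∧ p.1.length ≤ 2 * tsize l ∧ p.2.length ≤ tsize l := by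
  induction l generalizing p with
  | nil =>
    rw [List.mem_singleton.1 h]
    simp [val]
  | cons x l ih =>
    obtain ⟨q, hq, hpq⟩ := mem_of_mem_extend h
    have h₀ := ih hq
    obtain ⟨w, c⟩ := x
    have h₁ := length_lt_tsize w
    have h₂ := length_lt_tsize c
    simp only [tsize_cons, tsize_prod]
    rcases hpq with rfl | rfl
    · simp only [length_add]
      omega
    · simp only [val_add, val_count, length_add, length_count]
      omega

theorem length_front_le {α : Type} [TreeEnc α] (l : List (List α × List Bool)) :
    (front l).length ≤ tsize l + 1 := by
  cases l with
  | nil => simp [front]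
  | cons x l =>
    refine length_prune_le fun p hp => ?_
    obtain ⟨w, c⟩ := x
    have h₁ := length_lt_tsize w
    simp only [tsize_cons, tsize_prod]
    rcases List.mem_append.1 hp with hp | hp
    · obtain ⟨q, hq, rfl⟩ := List.mem_map.1 hp
      have := (bounds_of_mem_front hq).1
      dsimp only
      omega
    · obtain ⟨q, hq, rfl⟩ := List.mem_map.1 hp
      have := (bounds_of_mem_front hq).1
      simp only [val_add, val_count]
      omega

theorem tsize_front_le {α : Type} [TreeEnc α] (l : List (List α × List Bool)) :
    tsize (front l) ≤ (tsize l + 1) * (12 * tsize l + 4) + 1 := by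
  -- A word of `d` digits has size at most `4 * d + 1`; the two components have at most `2 * tsize
  -- l` and `tsize l` digits, and the pair adds a node.
  refine (tsize_le_length_mul (B := 12 * tsize l + 3) fun p hp => ?_).trans ?_
  · have h := bounds_of_mem_front hp
    obtain ⟨u, v⟩ := p
    have h₁ := tsize_le u
    have h₂ := tsize_le v
    simp only [tsize_prod]
    dsimp only at h
    omega
  · exact Nat.add_le_add_right (Nat.mul_le_mul_right _ (length_front_le l)) _

/-- The pairs of a kept weight and a deletion cost over all ways to delete some of the items. -/
def outcomes : List (ℕ × ℕ) → Set (ℕ × ℕ)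
  | [] => {(0, 0)}
  | x :: l => {p | ∃ q ∈ outcomes l, p = (q.1, q.2 + x.2) ∨ p = (q.1 + x.1, q.2)}

theorem mem_outcomes_ofFn {n : ℕ} (w c : Fin n → ℕ) (p : ℕ × ℕ) :
    p ∈ outcomes (List.ofFn fun i => (w i, c i)) ↔
      ∃ S : Finset (Fin n), p = (∑ i ∈ Sᶜ, w i, ∑ i ∈ S, c i) := by
  -- Indicator functions, with `true` for deletion, replace the sets, because `Fin.cons` fits the
  -- recursion on the list.
  have key : p ∈ outcomes (List.ofFn fun i => (w i, c i)) ↔ ∃ b : Fin n → Bool,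
      p = (∑ i, if b i then 0 else w i, ∑ i, if b i then c i else 0) := by
    induction n generalizing p with
    | zero => simp [outcomes]
    | succ n ih =>
      simp only [List.ofFn_succ, outcomes, Set.mem_ofPred_eq, ih, Fin.sum_univ_succ]
      constructor
      · rintro ⟨_, ⟨b, rfl⟩, rfl | rfl⟩
        · exact ⟨Fin.cons true b, by simp [add_comm]⟩
        · exact ⟨Fin.cons false b, by simp [add_comm]⟩
      · rintro ⟨b, rfl⟩
        refine ⟨_, ⟨fun i => b i.succ, rfl⟩, ?_⟩
        cases b 0
        · exact .inr (by simp [add_comm])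
        · exact .inl (by simp [add_comm])
  rw [key]
  constructor
  · rintro ⟨b, rfl⟩
    refine ⟨Finset.univ.filter fun i => b i = true, ?_⟩
    rw [Finset.compl_filter, Finset.sum_filter, Finset.sum_filter]
    simp only [ite_not]
  · rintro ⟨S, rfl⟩
    refine ⟨fun i => decide (i ∈ S), ?_⟩
    have h : Sᶜ = Finset.univ.filter fun i => i ∉ S := by ext; simp
    rw [h, Finset.sum_filter]
    simp

theorem front_sound {α : Type} {l : List (List α × List Bool)} {p : List Bool × List Bool}
    (h : p ∈ front l) :
    (val p.1, val p.2) ∈ outcomes (l.map fun x => (x.1.length, val x.2)) := by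
  induction l generalizing p with
  | nil =>
    rw [List.mem_singleton.1 h]
    simp [val, outcomes]
  | cons x l ih =>
    obtain ⟨q, hq, hpq⟩ := mem_of_mem_extend h
    refine ⟨_, ih hq, ?_⟩
    rcases hpq with rfl | rfl
    · exact .inl (by simp [val_add])
    · exact .inr (by simp [val_add, val_count])

/-- Deleting or keeping an item adds the same amounts to both of two comparable pairs, so domination
persists and a pruned pair is never needed later. -/
theorem front_complete {α : Type} {l : List (List α × List Bool)} {p : ℕ × ℕ}
    (h : p ∈ outcomes (l.map fun x => (x.1.length, val x.2))) :
    ∃ q ∈ front l, val q.1 ≤ p.1 ∧ val q.2 ≤ p.2 := by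
  induction l generalizing p with
  | nil => exact ⟨([], []), by simp [front], by simp [val], by simp [val]⟩
  | cons x l ih =>
    obtain ⟨q, hq, hpq⟩ := h
    obtain ⟨r, hr, h₁, h₂⟩ := ih hq
    rcases hpq with rfl | rfl
    · obtain ⟨s, hs, hs'⟩ := exists_dom_prune
        (L := (front l).map (fun p => (p.1, add p.2 x.2)) ++
          (front l).map fun p => (add p.1 (count x.1), p.2))
        (List.mem_append_left _ (List.mem_map.2 ⟨r, hr, rfl⟩))
      rw [dom_iff] at hs'
      simp only [val_add] at hs'
      exact ⟨s, hs, by dsimp only; omega, by dsimp only; omega⟩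
    · obtain ⟨s, hs, hs'⟩ := exists_dom_prune
        (L := (front l).map (fun p => (p.1, add p.2 x.2)) ++
          (front l).map fun p => (add p.1 (count x.1), p.2))
        (List.mem_append_right _ (List.mem_map.2 ⟨r, hr, rfl⟩))
      rw [dom_iff] at hs'
      simp only [val_add, val_count] at hs'
      exact ⟨s, hs, by dsimp only; omega, by dsimp only; omega⟩

end Knapsack

/-! ### The Pareto front in polynomial time. -/

namespace PolyTime

open Knapsack

variable {α γ : Type} [TreeEnc α] [TreeEnc γ]

@[fun_prop]
theorem dom {p q : γ → List Bool × List Bool} (hp : PolyTime p) (hq : PolyTime q) :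
    PolyTime fun c => Knapsack.dom (p c) (q c) := by
  unfold Knapsack.dom
  fun_prop

@[fun_prop]
theorem insert {p : γ → List Bool × List Bool} {L : γ → List (List Bool × List Bool)}
    (hp : PolyTime p) (hL : PolyTime L) : PolyTime fun c => Knapsack.insert (p c) (L c) := by
  have h₁ := any (q := fun c q => Knapsack.dom q (p c)) hL (by fun_prop)
  have h₂ := filter (q := fun c q => !Knapsack.dom (p c) q) hL (by fun_prop)
  unfold Knapsack.insert
  fun_prop

@[fun_prop]
theorem prune {L : γ → List (List Bool × List Bool)} (hL : PolyTime L) :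
    PolyTime fun c => Knapsack.prune (L c) := by
  refine foldr (f := fun _ => Knapsack.insert) hL (const _) (by fun_prop)
    ⟨_, hL.size, fun c w hw => le_trans ?_ hw.sublist.tsize_le⟩
  clear hw
  induction w with
  | nil => rfl
  | cons p w ih =>
    have h := tsize_insert_le p (w.foldr Knapsack.insert [])
    rw [List.foldr_cons, tsize_cons]
    omega

@[fun_prop]
theorem extend {x : γ → List α × List Bool} {L : γ → List (List Bool × List Bool)}
    (hx : PolyTime x) (hL : PolyTime L) : PolyTime fun c => Knapsack.extend (x c) (L c) := by
  have h₁ := map (f := fun c p => (p.1, Binary.add p.2 (x c).2)) hL (by fun_prop)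
  have h₂ := map (f := fun c p => (Binary.add p.1 (Binary.count (x c).1), p.2)) hL (by fun_prop)
  exact (h₁.append h₂).prune

-- The accumulators of the right fold are the fronts of suffixes, which pruning keeps of size
-- quadratic in that of the item list.
@[fun_prop]
theorem front {l : γ → List (List α × List Bool)} (hl : PolyTime l) :
    PolyTime fun c => Knapsack.front (l c) := by
  refine foldr (f := fun _ => Knapsack.extend) hl (const _) (by fun_prop)
    ⟨fun c => (tsize (l c) + 1) * (12 * tsize (l c) + 4) + 1, ?_, fun c w hw => ?_⟩
  · exact ((hl.size.add (.const 1)).mul (((PolyBdd.const 12).mul hl.size).add (.const 4))).add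
      (.const 1)
  · have h := hw.sublist.tsize_le
    refine (tsize_front_le w).trans ?_
    beta_reduce
    gcongr

end PolyTime

open TreeEnc BTree Knapsack

/-! ### The Kendall tau distance of lists of names -/

/-- The names `c` and `c'` of candidates, for all `c'` before `c` in `R` and after `c` in `X`. -/
def inversions (X R : List (List Bool)) : List (List Bool) :=
  X.flatMap fun c => (R.takeWhile fun d => !Binary.eq d c).filter fun c' =>
    (X.takeWhile fun d => !Binary.eq d c').any fun d => Binary.eq d c

@[fun_prop]
theorem PolyTime.inversions {γ : Type} [TreeEnc γ] {X R : γ → List (List Bool)} (hX : PolyTime X)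
    (hR : PolyTime R) : PolyTime fun c => inversions (X c) (R c) := by
  unfold _root_.inversions
  refine hX.flatMap (.filter (.takeWhile ?_ ?_) (.any (.takeWhile ?_ ?_) ?_)) <;> fun_prop

theorem Binary.val_encodeNat (a : ℕ) : Binary.val (Computability.encodeNat a) = a := by
  have h : ∀ p : PosNum, Binary.val (Computability.encodePosNum p) = p := by
    intro p
    induction p with
    | one => rfl
    | bit0 p ih => simp [Computability.encodePosNum, Binary.val, ih]; omega
    | bit1 p ih => simp [Computability.encodePosNum, Binary.val, ih]; omega
  have h' : ∀ p : Num, Binary.val (Computability.encodeNum p) = p := by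
    intro p
    cases p with
    | zero => rfl
    | pos p => exact h p
  rw [Computability.encodeNat, h', Num.to_of_nat]

/-- Also covers an absent `c`, since `idxOf` then returns the length of the list. -/
theorem List.mem_takeWhile_ne_iff {α : Type} [DecidableEq α] {l : List α} {c d : α} :
    d ∈ l.takeWhile (fun x => decide (x ≠ c)) ↔ d ∈ l ∧ l.idxOf d < l.idxOf c := by
  induction l with
  | nil => simp
  | cons x l ih =>
    rw [List.takeWhile_cons]
    by_cases hx : x = c
    · subst hx
      simp
    · by_cases hd : x = d
      · subst hd
        simp [hx, List.idxOf_cons_ne _ hx]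
      · rw [if_pos (by simpa using hx), List.mem_cons, ih, List.mem_cons, List.idxOf_cons_ne _ hx,
          List.idxOf_cons_ne _ hd]
        simp [Ne.symm hd]

namespace KemenyScore

/-- The binary names of the candidates from first to last. -/
def names {m : ℕ} (π : Ranking m) : List (List Bool) :=
  List.ofFn fun i => Computability.encodeNat (π i)

theorem eq_encodeNat {m : ℕ} (c d : Fin m) :
    Binary.eq (Computability.encodeNat c) (Computability.encodeNat d) = decide (c = d) := by
  rw [Bool.eq_iff_iff, Binary.eq_iff, Binary.val_encodeNat, Binary.val_encodeNat, decide_eq_true_iff,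
    Fin.val_inj]

theorem mem_takeWhile_ofFn_iff {m : ℕ} (π : Ranking m) (c d : Fin m) :
    d ∈ (List.ofFn π).takeWhile (fun x => decide (x ≠ c)) ↔ π.Before d c := by
  have key : ∀ e, (List.ofFn π).idxOf e = π.symm e := by
    intro e
    have h := (List.nodup_ofFn.2 π.injective).idxOf_getElem (π.symm e) (by simp)
    simpa using h
  rw [List.mem_takeWhile_ne_iff, key, key, Fin.val_fin_lt]
  exact and_iff_right (List.mem_ofFn.2 ⟨π.symm d, by simp⟩)

theorem names_eq_map {m : ℕ} (π : Ranking m) :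
    names π = (List.ofFn π).map fun c : Fin m => Computability.encodeNat c := by
  rw [List.map_ofFn]
  rfl

theorem takeWhile_names {m : ℕ} (π : Ranking m) (c : Fin m) :
    ((names π).takeWhile fun d => !Binary.eq d (Computability.encodeNat c)) =
      ((List.ofFn π).takeWhile fun x => decide (x ≠ c)).map
        fun c : Fin m => Computability.encodeNat c := by
  rw [names_eq_map, List.takeWhile_map]
  congr 2
  funext d
  simp [eq_encodeNat]

/-- For fixed `c` the inner list has no repetitions and consists of the names of those `c'` that
form a discordant pair with `c`. Summing over positions and reindexing by `π` sums over the
candidates. -/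
theorem length_inversions {m : ℕ} (π ρ : Ranking m) :
    (inversions (names π) (names ρ)).length = kendallTau π ρ := by
  have h₁ : ∀ c : Fin m, (((names ρ).takeWhile fun d => !Binary.eq d (Computability.encodeNat c)).filter
      fun c' => ((names π).takeWhile fun d => !Binary.eq d c').any
        fun d => Binary.eq d (Computability.encodeNat c)).length =
      (Finset.univ.filter fun c' => π.Before c c' ∧ ρ.Before c' c).card := by
    intro c
    rw [takeWhile_names, List.filter_map, List.length_map, ← List.toFinset_card_of_nodup]
    · congr 1
      ext c'
      simp only [List.mem_toFinset, List.mem_filter, mem_takeWhile_ofFn_iff, Function.comp_apply,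
        takeWhile_names, List.any_map, List.any_eq_true, eq_encodeNat, Finset.mem_filter,
        Finset.mem_univ, true_and, decide_eq_true_iff, exists_eq_right]
      exact and_comm
    · exact ((List.takeWhile_sublist _).nodup (List.nodup_ofFn.2 ρ.injective)).filter _
  rw [inversions, List.length_flatMap, names_eq_map π, List.map_map, ← names_eq_map π]
  simp only [Function.comp_def, h₁]
  rw [List.map_ofFn, List.sum_ofFn, kendallTau]
  simp only [Function.comp_def]
  rw [Equiv.sum_comp π fun c => (Finset.univ.filter fun c' => π.Before c c' ∧ ρ.Before c' c).card]
  simp only [Finset.card_filter, Fintype.sum_prod_type]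

end KemenyScore

/-! ### Parsing -/

/-- Symbols share their trees with triples of Booleans, so that case distinctions on symbols become
nested `if`s. -/
instance : TreeEnc Computability.Γ' where
  enc g := match g with
    | .bit b => enc (true, b, false)
    | .bra => enc (false, true, true)
    | .ket => enc (false, true, false)
    | .comma => enc (false, false, true)
    | .blank => enc (false, false, false)

namespace BTree

/-- The left subtree. -/
def left : BTree → BTree
  | leaf => leaf
  | node l _ => l

/-- The right subtree. -/
def right : BTree → BTree
  | leaf => leaf
  | node _ r => r

/-- Test for an inner node. -/
def isNode : BTree → Bool
  | leaf => false
  | node _ _ => true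

/-- Close a list `x` whose enclosing list is `y`: the list `x` is paired with the first element
of `y`, if there is any. -/
def close (x y : BTree) : BTree :=
  if y.isNode then node (node x y.left) y.right else node x leaf

/-- Process one symbol of an input word that is read from right to left: the state is the stack
of the lists that are incomplete. -/
def parseStep (s : BTree) (g : Computability.Γ') : BTree :=
  match g with
  | .bit b => node (node (node (enc b) s.left.left) s.left.right) s.right
  | .bra => node (close s.left s.right.left) s.right.right
  | .ket => node leaf s
  | .comma => node (node leaf s.left) s.right
  | .blank => s

/-- Parse a word that is given in reverse. -/
def parse (w : List Computability.Γ') : BTree := w.foldl parseStep (node leaf leaf)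

/-- Growth by a constant per symbol keeps the parser's state linear in the part of the input already
read, as a fold requires. -/
theorem size_parseStep_le (s : BTree) (g : Computability.Γ') : (parseStep s g).size ≤ s.size + 10 := by
  have hb : ∀ b : Bool, (enc b).size ≤ 3 := tsize_bool_le
  have hl : ∀ t : BTree, t.left.size + t.right.size ≤ t.size + 1 := by
    intro t
    cases t <;> simp [left, right, size]
    omega
  have h₁ := hl s
  have h₂ := hl s.left
  have h₃ := hl s.right
  have h₄ := hl s.right.left
  have h₅ := s.right.left.one_le_size
  cases g with
  | bit b =>
    have := hb b
    simp only [parseStep, size]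
    omega
  | bra =>
    simp only [parseStep, close]
    split <;> simp only [size] <;> omega
  | _ =>
    simp only [parseStep, size]
    omega

end BTree

/-! ### The parser in polynomial time. -/

namespace PolyTime

variable {γ : Type} [TreeEnc γ]

@[fun_prop]
theorem node {f g : γ → BTree} (hf : PolyTime f) (hg : PolyTime g) :
    PolyTime fun c => BTree.node (f c) (g c) := (hf.prodMk hg).of_enc fun _ => rfl

@[fun_prop]
theorem left {f : γ → BTree} (hf : PolyTime f) : PolyTime fun c => (f c).left :=
  branch (g := fun p : (BTree × BTree) × γ => p.1.1) hf (const BTree.leaf) (by fun_prop) fun c => by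
    rcases h : f c with _ | ⟨l, r⟩
    · exact .inl ⟨rfl, rfl⟩
    · exact .inr ⟨((l, r), c), ⟨_, _, rfl⟩, rfl, rfl⟩

@[fun_prop]
theorem right {f : γ → BTree} (hf : PolyTime f) : PolyTime fun c => (f c).right :=
  branch (g := fun p : (BTree × BTree) × γ => p.1.2) hf (const BTree.leaf) (by fun_prop) fun c => by
    rcases h : f c with _ | ⟨l, r⟩
    · exact .inl ⟨rfl, rfl⟩
    · exact .inr ⟨((l, r), c), ⟨_, _, rfl⟩, rfl, rfl⟩

@[fun_prop]
theorem isNode {f : γ → BTree} (hf : PolyTime f) : PolyTime fun c => (f c).isNode :=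
  branch (g := fun _ : (BTree × BTree) × γ => true) hf (const false) (by fun_prop) fun c => by
    rcases h : f c with _ | ⟨l, r⟩
    · exact .inl ⟨rfl, rfl⟩
    · exact .inr ⟨((l, r), c), ⟨_, _, rfl⟩, rfl, rfl⟩

@[fun_prop]
theorem enc {α : Type} [TreeEnc α] {f : γ → α} (hf : PolyTime f) :
    PolyTime fun c => TreeEnc.enc (f c) := hf.of_enc fun _ => rfl

/-- The kind of a symbol. -/
def symbolCode : Computability.Γ' → Bool × Bool × Bool
  | .bit b => (true, b, false)
  | .bra => (false, true, true)
  | .ket => (false, true, false)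
  | .comma => (false, false, true)
  | .blank => (false, false, false)

@[fun_prop]
theorem parseStep {s : γ → BTree} {g : γ → Computability.Γ'} (hs : PolyTime s) (hg : PolyTime g) :
    PolyTime fun c => BTree.parseStep (s c) (g c) := by
  have hk : PolyTime fun c => symbolCode (g c) := hg.of_enc fun c => by cases g c <;> rfl
  have h : PolyTime fun c => if (symbolCode (g c)).1 then
      BTree.node (BTree.node (BTree.node (TreeEnc.enc (symbolCode (g c)).2.1) (s c).left.left)
        (s c).left.right) (s c).right
    else if (symbolCode (g c)).2.1 then
      if (symbolCode (g c)).2.2 then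
        BTree.node (BTree.close (s c).left (s c).right.left) (s c).right.right
      else BTree.node BTree.leaf (s c)
    else if (symbolCode (g c)).2.2 then
      BTree.node (BTree.node BTree.leaf (s c).left) (s c).right
    else s c := by
    unfold BTree.close
    fun_prop
  convert h using 2 with c
  cases g c <;> rfl

@[fun_prop]
theorem parse {w : γ → List Computability.Γ'} (hw : PolyTime w) :
    PolyTime fun c => BTree.parse (w c) := by
  refine foldl (f := fun _ => BTree.parseStep) hw (const _) (by fun_prop)
    ⟨fun c => 10 * tsize (w c) + 3, ((PolyBdd.const 10).mul hw.size).add (.const 3),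
      fun c v hv => ?_⟩
  have key : ∀ s, (v.foldl BTree.parseStep s).size ≤ s.size + 10 * v.length := by
    clear hv
    induction v with
    | nil => intro s; rfl
    | cons g v ih =>
      intro s
      have h₁ := ih (BTree.parseStep s g)
      have h₂ := size_parseStep_le s g
      rw [List.foldl_cons, List.length_cons]
      omega
  have h₁ := (length_lt_tsize v).le.trans hv.sublist.tsize_le
  refine (key _).trans ?_
  beta_reduce
  have h₂ : (BTree.node leaf leaf).size = 3 := rfl
  omega

end PolyTime

/-! ### The decision procedure, its correctness, and parsing of encodings. -/

namespace KemenyScore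

open Computability

/-- The data of an instance as they are obtained from its encoding. -/
abbrev Data : Type :=
  ((List (List Bool) × List Bool) × List Bool × List (List (List Bool) × List Bool) × BTree) × BTree

/-- The data of an instance. -/
def Instance.data (I : Instance) : Data :=
  (((names I.X, encodeNat I.bgt), decide (I.k < 0) :: encodeNat I.k.natAbs,
    List.ofFn fun i => (names (I.R i), encodeNat (I.cost i)), leaf), leaf)

/-- The decision procedure. -/
def answer (d : Data) : Bool :=
  !d.1.2.1.headD false &&
    (Knapsack.front (d.1.2.2.1.map fun x => (inversions d.1.1.1 x.1, x.2))).any fun p =>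
      Binary.le p.1 d.1.2.1.tail && Binary.le p.2 d.1.1.2

theorem polyTime_answer : PolyTime answer := by
  have h₁ : PolyTime fun d : Data => d.1.2.2.1.map fun x => (inversions d.1.1.1 x.1, x.2) :=
    PolyTime.map (f := fun (d : Data) (x : List (List Bool) × List Bool) =>
      (inversions d.1.1.1 x.1, x.2)) (by fun_prop)
      (by fun_prop)
  have h₂ := h₁.front.any (q := fun (d : Data) p =>
    Binary.le p.1 d.1.2.1.tail && Binary.le p.2 d.1.1.2) (by fun_prop)
  unfold answer
  fun_prop

/-- A negative `k` is refused at once, since distances are nonnegative; otherwise the digits after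
the sign are those of `k` itself. -/
theorem answer_data (I : Instance) : answer I.data = true ↔ I.IsYes := by
  have hitems : (I.data.1.2.2.1.map fun x => (inversions I.data.1.1.1 x.1, x.2)).map
      (fun x => (x.1.length, Binary.val x.2)) =
      List.ofFn fun i => (kendallTau I.X (I.R i), I.cost i) := by
    simp only [Instance.data, List.map_ofFn, Function.comp_def, length_inversions,
      Binary.val_encodeNat]
  have hk : I.data.1.2.1.headD false = decide (I.k < 0) := rfl
  have hk' : Binary.val I.data.1.2.1.tail = I.k.natAbs := Binary.val_encodeNat _
  have hb : Binary.val I.data.1.1.2 = I.bgt := Binary.val_encodeNat _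
  rw [answer, Bool.and_eq_true, List.any_eq_true, hk]
  simp only [Bool.and_eq_true, Binary.le_iff, hk', hb, Bool.not_eq_true', decide_eq_false_iff_not]
  constructor
  · rintro ⟨h₀, p, hp, h₁, h₂⟩
    have hp := front_sound hp
    rw [hitems, mem_outcomes_ofFn] at hp
    obtain ⟨S, hS⟩ := hp
    obtain ⟨hw, hc⟩ := Prod.mk.inj hS
    exact ⟨S, hc ▸ h₂, by rw [← hw]; omega⟩
  · rintro ⟨S, h₂, h₁⟩
    obtain ⟨p, hp, hw, hc⟩ := front_complete (l := I.data.1.2.2.1.map fun x =>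
      (inversions I.data.1.1.1 x.1, x.2)) (by
        rw [hitems, mem_outcomes_ofFn]
        exact ⟨S, rfl⟩)
    dsimp only at hw hc
    exact ⟨by omega, p, hp, by omega, hc.trans h₂⟩

/-- Process a word from right to left. -/
def parseFrom (w : List Γ') (s : BTree) : BTree := w.foldr (fun g s => parseStep s g) s

theorem parseFrom_append (v w : List Γ') (s : BTree) :
    parseFrom (v ++ w) s = parseFrom v (parseFrom w s) :=
  List.foldr_append

/-- Read from the right, the comma opens an empty list at the front of the current one, and the
digits are then consed to it. -/
theorem parseFrom_bits (l : List Bool) (y s : BTree) :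
    parseFrom (l.map Γ'.bit ++ [Γ'.comma]) (node y s) = node (node (enc l) y) s := by
  induction l with
  | nil => rfl
  | cons b l ih =>
    change parseStep (parseFrom (l.map Γ'.bit ++ [Γ'.comma]) (node y s)) (Γ'.bit b) = _
    rw [ih]
    rfl

/-- Read from the right, `ket` opens a list and `bra` closes it; `close` then pairs the ranking with
the number that follows it in the word, its cost or the budget. -/
theorem parseFrom_encRanking {m : ℕ} (π : Ranking m) (y s : BTree) :
    parseFrom (encRanking π) (node y s) = node (close (enc (names π)) y) s := by
  have key : ∀ (l : List (Fin m)) (s : BTree),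
      parseFrom (l.map fun c : Fin m => encNat c).flatten (node leaf s) =
        node (enc (l.map fun c : Fin m => encodeNat c)) s := by
    intro l s
    induction l with
    | nil => rfl
    | cons c l ih =>
      rw [List.map_cons, List.flatten_cons, parseFrom_append, ih, encNat, parseFrom_bits]
      rfl
  have h := key (List.ofFn π) (node y s)
  rw [List.map_ofFn, ← names_eq_map] at h
  change parseStep (parseFrom (_ ++ [Γ'.ket]) (node y s)) Γ'.bra = _
  rw [parseFrom_append]
  change parseStep (parseFrom _ (node leaf (node y s))) Γ'.bra = _
  rw [show (fun i => encNat (π i : ℕ)) = (fun c : Fin m => encNat c) ∘ π from rfl, h]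
  rfl

/-- `Data` is shaped so that this holds literally: its two trailing leaves end the top-level list
and the parser's stack. The bracketed list of rankings has no number after it, so `close` makes it
an entry of its own. -/
theorem parse_encode (I : Instance) : parse I.encode.reverse = enc I.data := by
  have key : ∀ (l : List (Ranking I.m × ℕ)) (s : BTree),
      parseFrom (l.map fun x => encRanking x.1 ++ encNat x.2).flatten (node leaf s) =
        node (enc (l.map fun x => (names x.1, encodeNat x.2))) s := by
    intro l s
    induction l with
    | nil => rfl
    | cons x l ih =>
      rw [List.map_cons, List.flatten_cons, parseFrom_append, ih, parseFrom_append, encNat,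
        parseFrom_bits, parseFrom_encRanking]
      rfl
  have h := key (List.ofFn fun i => (I.R i, I.cost i)) (node leaf leaf)
  rw [List.map_ofFn, List.map_ofFn] at h
  simp only [Function.comp_def] at h
  have hk : ∀ y s, parseFrom (encInt I.k) (node y s) =
      node (node (enc (decide (I.k < 0) :: encodeNat I.k.natAbs)) y) s := fun y s =>
    parseFrom_bits (decide (I.k < 0) :: encodeNat I.k.natAbs) y s
  rw [parse, List.foldl_reverse]
  change parseFrom I.encode (node leaf leaf) = _
  have hlist : parseFrom (Γ'.bra :: (List.ofFn fun i => encRanking (I.R i) ++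
      encNat (I.cost i)).flatten ++ [Γ'.ket]) (node leaf leaf) =
      node (node (enc (List.ofFn fun i => (names (I.R i), encodeNat (I.cost i)))) leaf) leaf := by
    change parseStep (parseFrom (_ ++ [Γ'.ket]) (node leaf leaf)) Γ'.bra = _
    rw [parseFrom_append]
    change parseStep (parseFrom _ (node leaf (node leaf leaf))) Γ'.bra = _
    rw [h]
    rfl
  have hassoc : I.encode = encRanking I.X ++ (encNat I.bgt ++ (encInt I.k ++
      (Γ'.bra :: (List.ofFn fun i => encRanking (I.R i) ++ encNat (I.cost i)).flatten ++
        [Γ'.ket]))) := by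
    simp [Instance.encode]
  rw [hassoc, parseFrom_append, parseFrom_append, parseFrom_append, hlist, hk, encNat,
    parseFrom_bits, parseFrom_encRanking]
  rfl

/-- An instance is represented by its reversed encoding because this is what `readInput` leaves on
the stack `a`. -/
instance : TreeEnc Instance := ⟨fun I => enc I.encode.reverse⟩

theorem polyTime_answer_data : PolyTime fun I : Instance => answer I.data := by
  have h₁ : PolyTime fun I : Instance => I.encode.reverse := PolyTime.id.of_enc fun _ => rfl
  have h₂ : PolyTime fun I : Instance => I.data := h₁.parse.of_enc fun I => (parse_encode I).symm
  exact polyTime_answer.comp h₂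

end KemenyScore

/-! ### The machine -/

namespace TreeProg

open StackProg Computability

/-- Move one symbol, if it is among the given ones, from the input to the front of the list on the
stack `a`. -/
def readSymbol : List Γ' → TreeProg
  | [] => skip
  | g :: l => ite .inp (fun x : Option Γ' => decide (x = some g))
    (seq (pop .inp) (seq (pushWord (enc g).word) (push .a true))) (readSymbol l)

theorem runs_readSymbol {g : Γ'} {l : List Γ'} (hg : g ∈ l) {i o a b c} :
    (readSymbol l).Runs (st (g :: i) o a b c) (st i o (true :: ((enc g).word ++ a)) b c)
      (tsize g + l.length + 3) := by
  induction l with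
  | nil => simp at hg
  | cons h l ih =>
    by_cases hgh : g = h
    · subst hgh
      refine (Runs.ite_true (decide_eq_true (p := some g = some g) rfl) (runs_pop_inp.seq ((runs_pushWord _).seq
        (runs_push_a true)))).mono ?_
      rw [length_word]
      change _ ≤ (enc g).size + _ + 3
      rw [List.length_cons]
      omega
    · refine (Runs.ite_false (decide_eq_false fun h' => hgh (Option.some.inj h'))
        (ih ((List.mem_cons.1 hg).resolve_left hgh))).mono ?_
      rw [List.length_cons]
      omega

theorem tsize_symbol_le (g : Γ') : tsize g ≤ 11 := by
  rcases g with _ | (_ | _) | _ | _ | _ <;> decide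

/-- Move the input to the stack `a`. -/
def readInput : TreeProg :=
  seq (push .a false) (loop .inp Option.isSome
    (readSymbol [.blank, .bit false, .bit true, .bra, .ket, .comma]))

/-- Consing symbol by symbol reverses the word, and the initial bit `false` is the empty list. Each
symbol costs at most `11 + 6 + 3` steps in `readSymbol`, where `6` is the number of candidate
symbols, and one for the loop test. -/
theorem runs_readInput (w : List Γ') :
    readInput.Runs (st w [] [] [] []) (ts [] [] [enc w.reverse] []) (21 * w.length + 2) := by
  have key : ∀ v : List Γ', StackProg.Runs (loop (Γ := Stk.Alph) .inp Option.isSome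
      (readSymbol [.blank, .bit false, .bit true, .bra, .ket, .comma]))
      (st w [] (enc v).word [] []) (st [] [] (enc (w.reverse ++ v)).word [] [])
      (21 * w.length + 1) := by
    induction w with
    | nil => exact fun v => Runs.loop_false rfl
    | cons g w ih =>
      intro v
      have h := runs_readSymbol (g := g) (l := [.blank, .bit false, .bit true, .bra, .ket, .comma])
        (by rcases g with _ | (_ | _) | _ | _ | _ <;> simp) (i := w) (o := []) (a := (enc v).word)
        (b := []) (c := [])
      refine (Runs.loop_true rfl h (ih (g :: v))).congr (by simp) ?_
      have := tsize_symbol_le g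
      simp only [List.length_cons, List.length_nil]
      omega
  have h := key []
  rw [List.append_nil] at h
  refine ((runs_push_a false).seq h).congr ?_ (by omega)
  simp [ts]

/-- Move a truth value from the stack `a` to the output. -/
def writeOutput : TreeProg :=
  ite .a isTrue (seq (pop .a) (seq (pop .a) (seq (pop .a) (push .out true))))
    (seq (pop .a) (push .out false))

theorem runs_writeOutput (x : Bool) :
    writeOutput.Runs (ts [] [] [enc x] []) (st [] [x] [] [] []) 5 := by
  cases x
  · exact (Runs.ite_false rfl (runs_unleaf.seq (runs_push_out false))).mono (by omega)
  · exact Runs.ite_true rfl (runs_uncons.seq (runs_unleaf.seq (runs_unleaf.seq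
      (runs_push_out true))))

theorem initList_eq (p : TreeProg) [Fintype (Stk.Alph .inp)] (w : List Γ') :
    Turing.initList (p.toFinTM2 .inp .out) w =
      (⟨some (some p.entry), false, st w [] [] [] []⟩ :
        Turing.TM2.Cfg Stk.Alph (Option p.Lab) Bool) := by
  refine congrArg (fun s => (⟨some (some p.entry), false, s⟩ :
    Turing.TM2.Cfg Stk.Alph (Option p.Lab) Bool)) ?_
  funext k
  cases k <;> rfl

theorem haltList_eq (p : TreeProg) [Fintype (Stk.Alph .inp)] (w : List Bool) :
    Turing.haltList (p.toFinTM2 .inp .out) w =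
      (⟨none, false, st [] w [] [] []⟩ : Turing.TM2.Cfg Stk.Alph (Option p.Lab) Bool) := by
  refine congrArg (fun s => (⟨none, false, s⟩ :
    Turing.TM2.Cfg Stk.Alph (Option p.Lab) Bool)) ?_
  funext k
  cases k <;> rfl

end TreeProg

/-! ### Assembly of the machine and its running time. -/

namespace KemenyScore

open TreeProg StackProg Computability

theorem tsize_instance_le (I : Instance) : tsize I ≤ 12 * I.encode.length + 1 := by
  have h := tsize_le_length_mul (l := I.encode.reverse) fun g _ => tsize_symbol_le g
  rw [List.length_reverse] at h
  refine le_trans (b := I.encode.length * (11 + 1) + 1) h ?_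
  omega

instance : Fintype (Stk.Alph .inp) := inferInstanceAs (Fintype Γ')

open Polynomial in
theorem solvableInPolyTime_isYes : SolvableInPolyTime Instance.encode Instance.IsYes := by
  classical
  obtain ⟨p, n, ⟨P, hP⟩, -, hp⟩ := polyTime_answer_data
  have hrun : ∀ I : Instance, ∃ t ≤ (21 * X + P.comp (12 * X + 1) + 7 : ℕ[X]).eval I.encode.length,
      (seq readInput (seq p writeOutput)).Exec (st I.encode [] [] [] [])
        (st [] [answer I.data] [] [] []) t := by
    intro I
    refine ((runs_readInput I.encode).seq ((hp I [] [] [] []).seq (runs_writeOutput _))).mono ?_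
    have h := (hP I).trans (P.eval_mono_nat (tsize_instance_le I))
    simp [eval_comp]
    omega
  choose t ht hexec using hrun
  exact ⟨{
    tm := (seq readInput (seq p writeOutput)).toFinTM2 .inp .out
    inputAlphabet := Equiv.refl _
    outputAlphabet := Equiv.refl _
    -- The constant is `2` for reading, `5` for writing and `1` for halting; `12 * X + 1` bounds the
    -- size of the tree of the input.
    time := 21 * X + P.comp (12 * X + 1) + 8
    outputsFun := fun I =>
      { steps := t I + 1
        evals_in_steps := by
          have h := (hexec I).steps_toFinTM2 .inp .out
          have ha : answer I.data = decide I.IsYes := by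
            rw [Bool.eq_iff_iff, answer_data, decide_eq_true_iff]
          rw [← List.map_id I.encode, ← initList_eq, ← haltList_eq, ha] at h
          exact h
        steps_le_m := by
          have := ht I
          simp at this ⊢
          omega } }⟩

end KemenyScore

/-- Ranking Deletion-Kemeny Score is solvable in polynomial time. -/
theorem mainTheorem3 :
    KemenyScore.SolvableInPolyTime KemenyScore.Instance.encode KemenyScore.Instance.IsYes := by
  exact KemenyScore.solvableInPolyTime_isYes
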